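/- Let $\Gamma$ be a finite beam frame: finite sets $V$ of joints and $E$ of beams, where each beam $e$ has distinct origin and terminus joints, a length $\ell_e>0$, a right-handed orthonormal basis $\vec i_e,\vec j_e,\vec k_e$ of $\mathbb R^3$ and stiffness constants $a_e,b_e,c_e,d_e>0$. Let $s^e_{\mathfrak v}=1$ if $\mathfrak v$ is the origin of $e$, $-1$ if it is the terminus, and $0$ otherwise; write $e\sim\mathfrak v$ if $\mathfrak v$ is an endpoint of $e$. On $L^2(\Gamma)=\bigoplus_{e\in E}L^2(0,\ell_e)^4$ write $\Psi=(v_e,w_e,u_e,\eta_e)_{e\in E}$ and, at an endpoint of $e$, $$\vec g_e=u_e\vec i_e+w_e\vec j_e+v_e\vec k_e,\qquad \vec\omega_e=\eta_e\vec i_e-v_e'\vec j_e+w_e'\vec k_e,$$ $$F_{\mathfrak v}=\sum_{e\sim\mathfrak v}s^e_{\mathfrak v}\bigl(c_eu_e'\vec i_e-b_ew_e'''\vec j_e-a_ev_e'''\vec k_e\bigr),\qquad M_{\mathfrak v}=\sum_{e\sim\mathfrak v}s^e_{\mathfrak v}\bigl(d_e\eta_e'\vec i_e-a_ev_e''\vec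 j_e+b_ew_e''\vec k_e\bigr),$$ all evaluated at $\mathfrak v$. The rigidity conditions at $\mathfrak v$ are $\vec g_e=\vec g_{e'}=:\vec g_{\mathfrak v}$ and $\vec\omega_e=\vec\omega_{e'}=:\vec\omega_{\mathfrak v}$ for all $e,e'\sim\mathfrak v$ (at a joint with no beams, $\vec g_{\mathfrak v}=\vec\omega_{\mathfrak v}=0$). Put $$\mathcal U^{(e)}=\int_0^{\ell_e}\bigl(a_e|v_e''|^2+b_e|w_e''|^2+c_e|u_e'|^2+d_e|\eta_e'|^2\bigr)dx,\qquad \mathcal U^{(\mathfrak v)}=\tfrac12\bigl(|\vec g_{\mathfrak v}|^2\tan\alpha_{\mathfrak v}+|\vec\omega_{\mathfrak v}|^2\tan\beta_{\mathfrak v}\bigr).$$ We say that an energy functional with a given domain *has Hamiltonian* $H$ if it is the quadratic form of a densely defined, hermitian, semibounded, closed sesquilinear form $h$ with that domain, and $H$ is the operator associated with $h$ (that is, $\Psi\in\operatorname{Dom}H$ and $H\Psi=f$ if and only if $\Psi\in\operatorname{Dom}h$ and $h[\widetilde\Psi,\Psi]=\langle\widetilde\Psi,f\rangle$ for all $\widetilde\Psi\in\operatorname{Dom}h$).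 (1) Let $\alpha_{\mathfrak v},\beta_{\mathfrak v}\in(-\pi/2,\pi/2)$ for all $\mathfrak v$. The energy $\sum_e\mathcal U^{(e)}+\sum_{\mathfrak v}\mathcal U^{(\mathfrak v)}$, on the functions with $v_e,w_e\in H^2$, $u_e,\eta_e\in H^1$ satisfying the rigidity conditions at every joint, has a Hamiltonian $H$. It is self-adjoint and acts as $(v_e,w_e,u_e,\eta_e)\mapsto(a_ev_e'''',\,b_ew_e'''',\,-c_eu_e'',\,-d_e\eta_e'')$. Its domain consists exactly of the functions with $v_e,w_e\in H^4$, $u_e,\eta_e\in H^2$ that satisfy at every joint the rigidity conditions and $$\vec g_{\mathfrak v}\sin\alpha_{\mathfrak v}-2\cos\alpha_{\mathfrak v}\,F_{\mathfrak v}=0,\qquad \vec\omega_{\mathfrak v}\sin\beta_{\mathfrak v}-2\cos\beta_{\mathfrak v}\,M_{\mathfrak v}=0.$$ (2) Let $\alpha_{\mathfrak v},\beta_{\mathfrak v}\in(-\pi/2,\pi/2]$ for all $\mathfrak v$. The energy $\sum_e\mathcal U^{(e)}-\sum_{\mathfrak v}\bigl(|\vec g_{\mathfrak v}|^2\tan\alpha_{\mathfrak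 v}+|\vec\omega_{\mathfrak v}|^2\tan\beta_{\mathfrak v}\bigr)$, on the functions with $v_e,w_e\in H^2$, $u_e,\eta_e\in H^1$ satisfying the rigidity conditions at every joint and, in addition, $\vec g_{\mathfrak v}=0$ where $\alpha_{\mathfrak v}=\pi/2$ and $\vec\omega_{\mathfrak v}=0$ where $\beta_{\mathfrak v}=\pi/2$ (the corresponding terms of the energy are then omitted), has a Hamiltonian. It is self-adjoint and acts by the same differential expression. Its domain consists exactly of the functions with $v_e,w_e\in H^4$, $u_e,\eta_e\in H^2$ that satisfy at every joint the rigidity conditions and $$\vec g_{\mathfrak v}\sin\alpha_{\mathfrak v}+\cos\alpha_{\mathfrak v}\,F_{\mathfrak v}=0,\qquad \vec\omega_{\mathfrak v}\sin\beta_{\mathfrak v}+\cos\beta_{\mathfrak v}\,M_{\mathfrak v}=0.$$ (3) At a joint $\mathfrak v$ the conditions of (2) are equivalent to the following. Free joint, $\alpha_{\mathfrak v}=\beta_{\mathfrak v}=0$: rigidity, $F_{\mathfrak v}=0$ and $M_{\mathfrak v}=0$. Clamped, $\alpha_{\mathfrak v}=\beta_{\mathfrak v}=\pi/2$: $\vec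 g_e=\vec\omega_e=0$ for all $e\sim\mathfrak v$. Pinned, $\alpha_{\mathfrak v}=\pi/2$, $\beta_{\mathfrak v}=0$: $\vec g_e=0$ for all $e\sim\mathfrak v$, continuity of $\vec\omega$, and $M_{\mathfrak v}=0$. Guided, $\alpha_{\mathfrak v}=0$, $\beta_{\mathfrak v}=\pi/2$: $\vec\omega_e=0$ for all $e\sim\mathfrak v$, continuity of $\vec g$, and $F_{\mathfrak v}=0$. At a joint of degree one these become, at $\mathfrak v$: free, $u'=w'''=v'''=0$ and $\eta'=v''=w''=0$; clamped, $u=w=v=0$ and $\eta=v'=w'=0$; pinned, $u=w=v=0$ and $\eta'=v''=w''=0$; guided, $\eta=v'=w'=0$ and $u'=w'''=v'''=0$. -/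

import Mathlib

open MeasureTheory Filter Topology Set
open scoped ContDiff ComplexConjugate

/-! ### Sesquilinear forms on a Hilbert space -/

/-- A (not necessarily everywhere defined) sesquilinear form on a complex Hilbert space,
antilinear in the first argument. -/
structure SesqForm (X : Type*) [NormedAddCommGroup X] [InnerProductSpace ℂ X] where
  domain : Submodule ℂ X
  form : domain →ₗ⋆[ℂ] domain →ₗ[ℂ] ℂ

namespace SesqForm

variable {X : Type*} [NormedAddCommGroup X] [InnerProductSpace ℂ X]

def IsHermitian (q : SesqForm X) : Prop :=
  ∀ x y : q.domain, q.form x y = conj (q.form y x)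

def IsSemibounded (q : SesqForm X) : Prop :=
  ∃ m : ℝ, ∀ x : q.domain, m * ‖(x : X)‖ ^ 2 ≤ (q.form x x).re

/-- Closedness: if `xₙ` is in the domain, `xₙ → x` in the Hilbert space and
`q[xₙ - xₘ] → 0` as `n, m → ∞`, then `x` is in the domain and `q[xₙ - x] → 0`. -/
def IsClosed (q : SesqForm X) : Prop :=
  ∀ (s : ℕ → q.domain) (x : X), Tendsto (fun n => (s n : X)) atTop (𝓝 x) →
    Tendsto (fun p : ℕ × ℕ => q.form (s p.1 - s p.2) (s p.1 - s p.2)) atTop (𝓝 0) →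
    ∃ hx : x ∈ q.domain,
      Tendsto (fun n => q.form (s n - ⟨x, hx⟩) (s n - ⟨x, hx⟩)) atTop (𝓝 0)

/-- `H` is the operator associated with the form `q`: `x ∈ Dom H` and `H x = f` if and only if
`x` lies in the form domain and `q[y, x] = ⟨y, f⟩` for all `y` in the form domain. -/
def IsAssociated (q : SesqForm X) (H : X →ₗ.[ℂ] X) : Prop :=
  ∀ x f : X, (x, f) ∈ H.graph ↔
    ∃ hx : x ∈ q.domain, ∀ y : q.domain, q.form y ⟨x, hx⟩ = inner ℂ (y : X) f

end SesqForm

/-! ### Sobolev spaces on a bounded interval `(0, ℓ)` -/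

/-- The space `L²(0, ℓ)` of complex-valued functions. -/
abbrev IntervalL2 (ℓ : ℝ) : Type := Lp ℂ 2 (volume.restrict (Ioo (0 : ℝ) ℓ))

/-- `g` is the weak derivative of `f` on `(0, ℓ)`. -/
def HasWeakDeriv {ℓ : ℝ} (f g : IntervalL2 ℓ) : Prop :=
  ∀ φ : ℝ → ℝ, ContDiff ℝ ∞ φ → HasCompactSupport φ → tsupport φ ⊆ Ioo 0 ℓ →
    ∫ x in Ioo 0 ℓ, deriv φ x • f x = -∫ x in Ioo 0 ℓ, φ x • g x

/-- `f ∈ Hᵏ(0, ℓ)`: the weak derivatives of `f` up to order `k` exist in `L²(0, ℓ)`. -/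
def MemSobolev {ℓ : ℝ} : ℕ → IntervalL2 ℓ → Prop
  | 0, _ => True
  | k + 1, f => ∃ g, HasWeakDeriv f g ∧ MemSobolev k g

open Classical in
/-- The weak derivative in `L²(0, ℓ)` (unique if it exists; `0` if there is none). -/
noncomputable def weakDeriv {ℓ : ℝ} (f : IntervalL2 ℓ) : IntervalL2 ℓ :=
  if h : ∃ g, HasWeakDeriv f g then h.choose else 0

/-- The `k`-th weak derivative. -/
noncomputable def weakDerivN {ℓ : ℝ} (k : ℕ) (f : IntervalL2 ℓ) : IntervalL2 ℓ :=
  (weakDeriv (ℓ := ℓ))^[k] f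

open Classical in
/-- The value at `x ∈ [0, ℓ]` of the representative of `f` that is continuous on `[0, ℓ]`
(unique if it exists, as it does for `f ∈ H¹(0, ℓ)`; `0` if there is none). -/
noncomputable def contValue {ℓ : ℝ} (f : IntervalL2 ℓ) (x : ℝ) : ℂ :=
  if h : ∃ g : ℝ → ℂ, ContinuousOn g (Icc 0 ℓ) ∧ f =ᵐ[volume.restrict (Ioo (0 : ℝ) ℓ)] g
  then h.choose x else 0

/-! ### Beam frames -/

/-- The four fields on a beam: lateral displacements `v`, `w`, axial displacement `u`,
angular displacement `η`. -/
inductive Field4 where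
  | v | w | u | η
  deriving DecidableEq

instance : Fintype Field4 where
  elems := {.v, .w, .u, .η}
  complete F := by cases F <;> decide

/-- A beam frame with joints `V` and beams `E`: each beam has an origin, a terminus, a length,
a right-handed orthonormal material basis `i, j, k` and positive stiffnesses `a, b, c, d`. -/
structure BeamFrame (V E : Type*) where
  origin : E → V
  terminus : E → V
  origin_ne_terminus : ∀ e, origin e ≠ terminus e
  length : E → ℝ
  length_pos : ∀ e, 0 < length e
  i : E → EuclideanSpace ℝ (Fin 3)
  j : E → EuclideanSpace ℝ (Fin 3)
  k : E → EuclideanSpace ℝ (Fin 3)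
  orthonormal : ∀ e, Orthonormal ℝ ![i e, j e, k e]
  right_handed : ∀ e, (i e).ofLp = crossProduct (j e).ofLp (k e).ofLp
  a : E → ℝ
  b : E → ℝ
  c : E → ℝ
  d : E → ℝ
  a_pos : ∀ e, 0 < a e
  b_pos : ∀ e, 0 < b e
  c_pos : ∀ e, 0 < c e
  d_pos : ∀ e, 0 < d e

/-- A real vector viewed in `ℂ³`. -/
noncomputable def toC3 (x : EuclideanSpace ℝ (Fin 3)) : EuclideanSpace ℂ (Fin 3) :=
  WithLp.toLp 2 fun m => (x m : ℂ)

namespace BeamFrame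

variable {V E : Type*} (Γ : BeamFrame V E)

/-- The Hilbert space `L²(Γ)`: the orthogonal direct sum over the beams `e` of four copies of
`L²(0, ℓ_e)`, one for each field. -/
abbrev State : Type _ := PiLp 2 fun p : E × Field4 => IntervalL2 (Γ.length p.1)

/-- The beam `e` is incident to the joint `x`. -/
def Incident (e : E) (x : V) : Prop := Γ.origin e = x ∨ Γ.terminus e = x

open Classical in
/-- The signed incidence indicator. -/
noncomputable def sign (x : V) (e : E) : ℝ :=
  if Γ.origin e = x then 1 else if Γ.terminus e = x then -1 else 0

open Classical in
/-- The arc-length coordinate on `e` of the incident joint `x`. -/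
noncomputable def coord (x : V) (e : E) : ℝ :=
  if Γ.origin e = x then 0 else Γ.length e

/-- The value at the joint `x` of the `n`-th derivative of the field `F` on the incident
beam `e`. -/
noncomputable def val (Ψ : Γ.State) (e : E) (F : Field4) (n : ℕ) (x : V) : ℂ :=
  contValue (weakDerivN n (Ψ (e, F))) (Γ.coord x e)

/-- The displacement `u i + w j + v k` of the beam `e` at the joint `x`. -/
noncomputable def disp (Ψ : Γ.State) (e : E) (x : V) : EuclideanSpace ℂ (Fin 3) :=
  Γ.val Ψ e .u 0 x • toC3 (Γ.i e) + Γ.val Ψ e .w 0 x • toC3 (Γ.j e)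
    + Γ.val Ψ e .v 0 x • toC3 (Γ.k e)

/-- The rotation vector `η i - v' j + w' k` of the beam `e` at the joint `x`. -/
noncomputable def rot (Ψ : Γ.State) (e : E) (x : V) : EuclideanSpace ℂ (Fin 3) :=
  Γ.val Ψ e .η 0 x • toC3 (Γ.i e) - Γ.val Ψ e .v 1 x • toC3 (Γ.j e)
    + Γ.val Ψ e .w 1 x • toC3 (Γ.k e)

def DispContinuousAt (Ψ : Γ.State) (x : V) : Prop :=
  ∀ e e', Γ.Incident e x → Γ.Incident e' x → Γ.disp Ψ e x = Γ.disp Ψ e' x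

def RotContinuousAt (Ψ : Γ.State) (x : V) : Prop :=
  ∀ e e', Γ.Incident e x → Γ.Incident e' x → Γ.rot Ψ e x = Γ.rot Ψ e' x

open Classical in
/-- The joint displacement `g_x := g_e(x)` for any `e` incident to `x`
(`0` at a joint without beams). -/
noncomputable def jointDisp (Ψ : Γ.State) (x : V) : EuclideanSpace ℂ (Fin 3) :=
  if h : ∃ e, Γ.Incident e x then Γ.disp Ψ h.choose x else 0

open Classical in
/-- The joint rotation `ω_x := ω_e(x)` for any `e` incident to `x`
(`0` at a joint without beams). -/
noncomputable def jointRot (Ψ : Γ.State) (x : V) : EuclideanSpace ℂ (Fin 3) :=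
  if h : ∃ e, Γ.Incident e x then Γ.rot Ψ h.choose x else 0

/-- `Ψ ∈ ⨁ H²(e) ⊕ ⨁ H²(e) ⊕ ⨁ H¹(e) ⊕ ⨁ H¹(e)`. -/
def MemFormSobolev (Ψ : Γ.State) : Prop :=
  ∀ e, MemSobolev 2 (Ψ (e, .v)) ∧ MemSobolev 2 (Ψ (e, .w)) ∧
    MemSobolev 1 (Ψ (e, .u)) ∧ MemSobolev 1 (Ψ (e, .η))

/-- `Ψ ∈ ⨁ H⁴(e) ⊕ ⨁ H⁴(e) ⊕ ⨁ H²(e) ⊕ ⨁ H²(e)`. -/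
def MemOpSobolev (Ψ : Γ.State) : Prop :=
  ∀ e, MemSobolev 4 (Ψ (e, .v)) ∧ MemSobolev 4 (Ψ (e, .w)) ∧
    MemSobolev 2 (Ψ (e, .u)) ∧ MemSobolev 2 (Ψ (e, .η))

/-- `Φ = (a v'''', b w'''', -c u'', -d η'')` on every beam, where `Ψ = (v, w, u, η)`. -/
def IsDiffExpr (Ψ Φ : Γ.State) : Prop :=
  ∀ e, Φ (e, .v) = Γ.a e • weakDerivN 4 (Ψ (e, .v)) ∧
    Φ (e, .w) = Γ.b e • weakDerivN 4 (Ψ (e, .w)) ∧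
    Φ (e, .u) = -(Γ.c e • weakDerivN 2 (Ψ (e, .u))) ∧
    Φ (e, .η) = -(Γ.d e • weakDerivN 2 (Ψ (e, .η)))

/-- The strain energy of the beam `e`. -/
noncomputable def beamEnergy (Ψ : Γ.State) (e : E) : ℝ :=
  ∫ x in Ioo 0 (Γ.length e),
    (Γ.a e * ‖weakDerivN 2 (Ψ (e, .v)) x‖ ^ 2 + Γ.b e * ‖weakDerivN 2 (Ψ (e, .w)) x‖ ^ 2
      + Γ.c e * ‖weakDerivN 1 (Ψ (e, .u)) x‖ ^ 2 + Γ.d e * ‖weakDerivN 1 (Ψ (e, .η)) x‖ ^ 2)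

/-- The vertex energy `½ (|g_x|² tan α_x + |ω_x|² tan β_x)`. -/
noncomputable def vertexEnergy (α β : V → ℝ) (Ψ : Γ.State) (x : V) : ℝ :=
  1 / 2 * (‖Γ.jointDisp Ψ x‖ ^ 2 * Real.tan (α x) + ‖Γ.jointRot Ψ x‖ ^ 2 * Real.tan (β x))

variable [Fintype E]

/-- The sum of forces `∑_{e ∼ x} s_x^e (c u' i - b w''' j - a v''' k)` at the joint `x`;
the sign vanishes for beams not incident to `x`. -/
noncomputable def force (Ψ : Γ.State) (x : V) : EuclideanSpace ℂ (Fin 3) :=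
  ∑ e, Γ.sign x e • ((Γ.c e * Γ.val Ψ e .u 1 x) • toC3 (Γ.i e)
    - (Γ.b e * Γ.val Ψ e .w 3 x) • toC3 (Γ.j e) - (Γ.a e * Γ.val Ψ e .v 3 x) • toC3 (Γ.k e))

/-- The sum of moments `∑_{e ∼ x} s_x^e (d η' i - a v'' j + b w'' k)` at the joint `x`. -/
noncomputable def moment (Ψ : Γ.State) (x : V) : EuclideanSpace ℂ (Fin 3) :=
  ∑ e, Γ.sign x e • ((Γ.d e * Γ.val Ψ e .η 1 x) • toC3 (Γ.i e)
    - (Γ.a e * Γ.val Ψ e .v 2 x) • toC3 (Γ.j e) + (Γ.b e * Γ.val Ψ e .w 2 x) • toC3 (Γ.k e))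

/-- The four vertex conditions at the joint `x`: continuity of displacement, continuity of
rotation, `g sin α + cos α ∑ forces = 0` and `ω sin β + cos β ∑ moments = 0`. -/
def VertexConditions (α β : V → ℝ) (Ψ : Γ.State) (x : V) : Prop :=
  Γ.DispContinuousAt Ψ x ∧ Γ.RotContinuousAt Ψ x ∧
    Real.sin (α x) • Γ.jointDisp Ψ x + Real.cos (α x) • Γ.force Ψ x = 0 ∧
    Real.sin (β x) • Γ.jointRot Ψ x + Real.cos (β x) • Γ.moment Ψ x = 0

/-- The functional `U` on the domain `D` is the quadratic form of a densely defined, hermitian,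
semibounded, closed sesquilinear form, whose associated operator is self-adjoint, acts by the
differential expression, and has as its domain the functions in
`⨁ H⁴(e) ⊕ ⨁ H⁴(e) ⊕ ⨁ H²(e) ⊕ ⨁ H²(e)` that satisfy the conditions `bc`. -/
def HasHamiltonian (D : Γ.State → Prop) (U : Γ.State → ℝ) (bc : Γ.State → Prop) : Prop :=
  ∃ (q : SesqForm Γ.State) (H : Γ.State →ₗ.[ℂ] Γ.State),
    (∀ Ψ, Ψ ∈ q.domain ↔ D Ψ) ∧
    (∀ Ψ : q.domain, q.form Ψ Ψ = (U Ψ : ℂ)) ∧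
    Dense (q.domain : Set Γ.State) ∧ q.IsHermitian ∧ q.IsSemibounded ∧ q.IsClosed ∧
    q.IsAssociated H ∧ IsSelfAdjoint H ∧
    (∀ Ψ, Ψ ∈ H.domain ↔ Γ.MemOpSobolev Ψ ∧ bc Ψ) ∧
    (∀ Ψ : H.domain, Γ.IsDiffExpr Ψ (H Ψ))

end BeamFrame

/-! An H² field is determined by its value and slope at 0 together with its second derivative, and
an H¹ field by its value at 0 together with its first derivative. The form domain is therefore the
injective image, under the bounded map `formEmb`, of a closed subspace of ℂᴺ ⊕ L²(Γ). In these
coordinates displacements and rotations of joints are bounded linear maps, so the energy is y ↦ ⟨y,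
S y⟩ with S bounded and symmetric, and everything reduces to abstract Hilbert space theory for an
embedding j : Y → X.

The beam energy controls the top derivatives but not the initial values, and the joint terms may be
negative. Both obstructions are finite sums of squares of bounded functionals. When j is injective
the range of its adjoint is dense, so each such square is at most ε‖y‖² + C‖j y‖²
(`RelSmall.norm_sq_functional`). Hence the energy plus a multiple of ‖j y‖² is coercive
(`exists_coercive`), which gives semiboundedness and closedness; the representation theorem
`embeddedForm.exists_isAssociated` supplies the self-adjoint operator.

To find its domain, the weak equation is first tested with single fields that vanish at both ends of
a beam (with their slopes, for v and w). A du Bois-Reymond argument then yields regularity and the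
differential expression. By Green's identity (`green`) what remains is a sum over joints that pairs
test displacements and rotations with the defects θg − F and φω − M. Test joint data can be
prescribed freely outside the constrained joints (`exists_formParam_joint`); taking them equal to
the defects turns the sum into a sum of squares, which forces the natural conditions.

Both energies are instances of `hasHamiltonian`: θ = tan α / 2 without constraints, and θ = −tan α
with constraints where an angle is π/2. The special joints are then algebra in an orthonormal basis.
-/

/-! ### Forms on a Hilbert space embedded in another one -/

section EmbeddedForm

variable {X Y : Type*} [NormedAddCommGroup X] [InnerProductSpace ℂ X]
  [NormedAddCommGroup Y] [InnerProductSpace ℂ Y]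

/-- A functional `f` is small relative to the embedding `j`: it is bounded by an arbitrarily small
multiple of `‖y‖ ^ 2` plus a multiple of `‖j y‖ ^ 2`. -/
def RelSmall (j : Y →L[ℂ] X) (f : Y → ℝ) : Prop :=
  ∀ ε > 0, ∃ C : ℝ, ∀ y, f y ≤ ε * ‖y‖ ^ 2 + C * ‖j y‖ ^ 2

namespace RelSmall

variable {j : Y →L[ℂ] X} {f g : Y → ℝ}

theorem add (hf : RelSmall j f) (hg : RelSmall j g) : RelSmall j fun y => f y + g y := by
  intro ε hε
  obtain ⟨C, hC⟩ := hf (ε / 2) (by positivity)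
  obtain ⟨D, hD⟩ := hg (ε / 2) (by positivity)
  exact ⟨C + D, fun y => by linarith [hC y, hD y]⟩

theorem sum {ι : Type*} (s : Finset ι) {f : ι → Y → ℝ} (hf : ∀ i ∈ s, RelSmall j (f i)) :
    RelSmall j fun y => ∑ i ∈ s, f i y := by
  classical
  induction s using Finset.induction_on with
  | empty => exact fun ε hε => ⟨0, fun y => by simp; positivity⟩
  | insert a s ha ih =>
    simp only [Finset.sum_insert ha]
    exact (hf a (by simp)).add (ih fun i hi => hf i (by simp [hi]))

theorem const_mul (hf : RelSmall j f) {r : ℝ} (hr : 0 ≤ r) : RelSmall j fun y => r * f y := by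
  intro ε hε
  obtain ⟨C, hC⟩ := hf (ε / (r + 1)) (by positivity)
  refine ⟨r * C, fun y => ?_⟩
  have h1 := mul_le_mul_of_nonneg_left (hC y) hr
  have h2 : r * (ε / (r + 1)) ≤ ε := by
    rw [mul_div_assoc', div_le_iff₀ (by positivity)]
    nlinarith
  nlinarith [mul_le_mul_of_nonneg_right h2 (sq_nonneg ‖y‖)]

/-- A bounded functional is small relative to an injective embedding. -/
theorem norm_sq_functional [CompleteSpace X] [CompleteSpace Y] (hj : Function.Injective j)
    (T : Y →L[ℂ] ℂ) : RelSmall j fun y => ‖T y‖ ^ 2 := by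
  intro ε hε
  -- The orthogonal complement of the range of the adjoint is ker j = 0. The vector representing T
  -- can thus be approximated by some j* x, whose pairing with y sees only j y.
  have hdense : (LinearMap.range (ContinuousLinearMap.adjoint j).toLinearMap).topologicalClosure
      = ⊤ := by
    rw [Submodule.topologicalClosure_eq_top_iff, ContinuousLinearMap.orthogonal_range,
      ContinuousLinearMap.adjoint_adjoint]
    exact LinearMap.ker_eq_bot.2 hj
  obtain ⟨t, ht⟩ : ∃ t : Y, ∀ y, T y = inner ℂ t y :=
    ⟨(InnerProductSpace.toDual ℂ Y).symm T, fun y => by simp⟩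
  -- The tolerance is √(ε/2) because (a + b)² ≤ 2a² + 2b² costs a factor 2 at the end.
  have hδ : 0 < Real.sqrt (ε / 2) := by positivity
  have hmem : t ∈ closure (LinearMap.range (ContinuousLinearMap.adjoint j).toLinearMap : Set Y) := by
    rw [← Submodule.topologicalClosure_coe, hdense]; trivial
  obtain ⟨_, ⟨x, rfl⟩, hx⟩ := Metric.mem_closure_iff.1 hmem _ hδ
  refine ⟨2 * ‖x‖ ^ 2, fun y => ?_⟩
  set z : Y := ContinuousLinearMap.adjoint j x
  have h1 : T y = inner ℂ (t - z) y + inner ℂ x (j y) := by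
    rw [ht, inner_sub_left, ContinuousLinearMap.adjoint_inner_left]; ring
  have h2 : ‖T y‖ ≤ Real.sqrt (ε / 2) * ‖y‖ + ‖x‖ * ‖j y‖ := by
    rw [h1]
    refine (norm_add_le _ _).trans (add_le_add ((norm_inner_le_norm _ _).trans ?_)
      (norm_inner_le_norm _ _))
    gcongr
    rw [← dist_eq_norm]
    exact hx.le
  have h3 := Real.sq_sqrt (show 0 ≤ ε / 2 by positivity)
  calc ‖T y‖ ^ 2 ≤ (Real.sqrt (ε / 2) * ‖y‖ + ‖x‖ * ‖j y‖) ^ 2 := by gcongr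
    _ ≤ 2 * (Real.sqrt (ε / 2) * ‖y‖) ^ 2 + 2 * (‖x‖ * ‖j y‖) ^ 2 := by
      nlinarith [sq_nonneg (Real.sqrt (ε / 2) * ‖y‖ - ‖x‖ * ‖j y‖)]
    _ = _ := by rw [mul_pow, h3]; ring

/-- A bounded operator into a Euclidean space is small relative to an injective embedding. -/
theorem norm_sq_euclidean [CompleteSpace X] [CompleteSpace Y] (hj : Function.Injective j)
    {n : Type*} [Fintype n] (T : Y →L[ℂ] EuclideanSpace ℂ n) : RelSmall j fun y => ‖T y‖ ^ 2 := by
  simp only [EuclideanSpace.norm_sq_eq]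
  exact sum _ fun i _ => norm_sq_functional hj ((EuclideanSpace.proj i).comp T)

end RelSmall

/-- The form `(j z, j y) ↦ ⟨z, S y⟩` on the range of the injective map `j`. -/
noncomputable def embeddedForm (j : Y →L[ℂ] X) (hj : Function.Injective j) (S : Y →L[ℂ] Y) :
    SesqForm X where
  domain := LinearMap.range j.toLinearMap
  form :=
    let r := (LinearEquiv.ofInjective j.toLinearMap hj).symm
    LinearMap.mk₂'ₛₗ (starRingEnd ℂ) (RingHom.id ℂ) (fun z y => inner ℂ (r z) (S (r y)))
      (fun _ _ _ => by rw [map_add, inner_add_left])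
      (fun _ _ _ => by rw [map_smul, inner_smul_left]; rfl)
      (fun _ _ _ => by rw [map_add, map_add, inner_add_right])
      (fun _ _ _ => by rw [map_smul, map_smul, inner_smul_right]; rfl)

namespace embeddedForm

variable {j : Y →L[ℂ] X} {hj : Function.Injective j} {S : Y →L[ℂ] Y}

/-- The element of the form domain given by `y`. -/
def mk (hj : Function.Injective j) (S : Y →L[ℂ] Y) (y : Y) : (embeddedForm j hj S).domain :=
  ⟨j y, y, rfl⟩

theorem mk_surjective (x : (embeddedForm j hj S).domain) : ∃ y, mk hj S y = x := by
  obtain ⟨_, y, rfl⟩ := x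
  exact ⟨y, rfl⟩

theorem mk_sub (y z : Y) : mk hj S (y - z) = mk hj S y - mk hj S z :=
  Subtype.ext (map_sub j y z)

theorem coe_mk (y : Y) : (mk hj S y : X) = j y := rfl

theorem form_mk (z y : Y) :
    (embeddedForm j hj S).form (mk hj S z) (mk hj S y) = inner ℂ z (S y) := by
  have h (y : Y) : (LinearEquiv.ofInjective j.toLinearMap hj).symm (mk hj S y) = y :=
    (LinearEquiv.symm_apply_eq _).2 rfl
  change inner ℂ ((LinearEquiv.ofInjective j.toLinearMap hj).symm (mk hj S z))
    (S ((LinearEquiv.ofInjective j.toLinearMap hj).symm (mk hj S y))) = _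
  rw [h, h]

theorem isHermitian (hS : ∀ x y, inner ℂ (S x) y = inner ℂ x (S y)) :
    (embeddedForm j hj S).IsHermitian := by
  intro x y
  obtain ⟨x, rfl⟩ := mk_surjective x
  obtain ⟨y, rfl⟩ := mk_surjective y
  rw [form_mk, form_mk, inner_conj_symm, hS]

variable {κ K : ℝ}

theorem isSemibounded (hκ : 0 < κ)
    (hc : ∀ y, κ * ‖y‖ ^ 2 ≤ (inner ℂ y (S y)).re + K * ‖j y‖ ^ 2) :
    (embeddedForm j hj S).IsSemibounded := by
  refine ⟨-K, fun x => ?_⟩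
  obtain ⟨y, rfl⟩ := mk_surjective x
  rw [form_mk, coe_mk]
  have : 0 ≤ κ * ‖y‖ ^ 2 := by positivity
  linarith [hc y]

/-- Coercivity bounds ‖yₙ − yₘ‖² by the form at the difference plus a multiple of ‖j (yₙ − yₘ)‖².
Convergence in X together with the form-Cauchy condition is therefore convergence in the complete
space Y, where the form is continuous. -/
theorem isClosed [CompleteSpace Y] (hκ : 0 < κ)
    (hc : ∀ y, κ * ‖y‖ ^ 2 ≤ (inner ℂ y (S y)).re + K * ‖j y‖ ^ 2) :
    (embeddedForm j hj S).IsClosed := by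
  intro s x hs hq
  choose y hy using fun n => mk_surjective (s n)
  obtain rfl : (fun n => mk hj S (y n)) = s := funext hy
  simp only [← mk_sub, form_mk, coe_mk] at hs hq
  have hcauchy : CauchySeq y := by
    rw [cauchySeq_iff_tendsto_dist_atTop_0]
    have h1 : Tendsto (fun p : ℕ × ℕ => ‖j (y p.1 - y p.2)‖) atTop (𝓝 0) := by
      have := cauchySeq_iff_tendsto_dist_atTop_0.1 hs.cauchySeq
      simpa only [dist_eq_norm, map_sub] using this
    have h2 := ((Complex.continuous_re.tendsto _).comp hq).add ((h1.pow 2).const_mul K)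
    have h3 := h2.div_const κ
    simp only [Complex.zero_re, ne_eq, OfNat.ofNat_ne_zero, not_false_eq_true, zero_pow, mul_zero,
      add_zero, zero_div, Function.comp_apply] at h3
    have h4 := squeeze_zero (fun p : ℕ × ℕ => sq_nonneg ‖y p.1 - y p.2‖) (fun p => by
      rw [le_div_iff₀ hκ, mul_comm]
      exact hc (y p.1 - y p.2)) h3
    have h5 := (Real.continuous_sqrt.tendsto _).comp h4
    simp only [Real.sqrt_zero] at h5
    refine h5.congr fun p => ?_
    rw [Function.comp_apply, Real.sqrt_sq (norm_nonneg _), dist_eq_norm]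
  obtain ⟨z, hz⟩ := cauchySeq_tendsto_of_complete hcauchy
  obtain rfl : j z = x := tendsto_nhds_unique ((j.continuous.tendsto z).comp hz) hs
  refine ⟨⟨z, rfl⟩, ?_⟩
  have h6 (n : ℕ) : mk hj S (y n) - ⟨j z, z, rfl⟩ = mk hj S (y n - z) := (mk_sub _ _).symm
  simp only [h6, form_mk]
  have h7 : Tendsto (fun n => y n - z) atTop (𝓝 0) := by
    simpa using hz.sub_const z
  simpa only [map_zero, inner_zero_left, Function.comp_apply] using
    h7.inner (𝕜 := ℂ) ((S.continuous.tendsto 0).comp h7)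

end embeddedForm

/-- A symmetric densely defined operator `H` such that `H + c` is onto for some real `c` is
self-adjoint. -/
theorem LinearPMap.isSelfAdjoint_of_surjective [CompleteSpace X] {H : X →ₗ.[ℂ] X}
    (hd : Dense (H.domain : Set X)) (hs : H.IsFormalAdjoint H) (c : ℝ)
    (hc : ∀ f : X, ∃ x : H.domain, H x + (c : ℂ) • (x : X) = f) : IsSelfAdjoint H := by
  rw [LinearPMap.isSelfAdjoint_def]
  have hle := hs.le_adjoint hd
  refine (LinearPMap.eq_of_le_of_domain_eq hle (le_antisymm hle.1 fun y hy => ?_)).symm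
  obtain ⟨x, hx⟩ := hc (LinearPMap.adjoint H ⟨y, hy⟩ + (c : ℂ) • y)
  -- The difference lies in the kernel of H* + c. Writing it as (H + c) z and pairing it with itself
  -- moves H + c onto it, which gives zero.
  have key : y - x = 0 := by
    obtain ⟨z, hz⟩ := hc (y - x)
    have h1 : inner ℂ (LinearPMap.adjoint H ⟨y, hy⟩) (z : X) = inner ℂ y (H z) :=
      LinearPMap.adjoint_isFormalAdjoint hd ⟨y, hy⟩ z
    have h2 : inner ℂ (H x) (z : X) = inner ℂ (x : X) (H z) := hs x z
    have h3 := congrArg (fun w => inner ℂ w (z : X)) hx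
    simp only [inner_add_left, inner_smul_left, Complex.conj_ofReal, h1, h2] at h3
    rw [← inner_self_eq_zero (𝕜 := ℂ)]
    nth_rw 2 [← hz]
    rw [inner_add_right, inner_smul_right, inner_sub_left, inner_sub_left]
    linear_combination -h3
  rw [sub_eq_zero.1 key]
  exact x.2

/-- The representation theorem for a coercive symmetric form on an embedded Hilbert space. -/
theorem embeddedForm.exists_isAssociated [CompleteSpace X] [CompleteSpace Y]
    {j : Y →L[ℂ] X} (hj : Function.Injective j) {S : Y →L[ℂ] Y} (hd : DenseRange j)
    (hS : ∀ x y, inner ℂ (S x) y = inner ℂ x (S y)) {κ K : ℝ} (hκ : 0 < κ)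
    (hc : ∀ y, κ * ‖y‖ ^ 2 ≤ (inner ℂ y (S y)).re + K * ‖j y‖ ^ 2) :
    ∃ H : X →ₗ.[ℂ] X, (embeddedForm j hj S).IsAssociated H ∧ IsSelfAdjoint H := by
  -- The graph of H is defined by the weak equation itself; density of the range of j makes it
  -- single-valued.
  let G : Submodule ℂ (X × X) :=
    { carrier := {p | ∃ y, j y = p.1 ∧ ∀ z, inner ℂ z (S y) = inner ℂ (j z) p.2}
      add_mem' := by
        rintro ⟨_, f⟩ ⟨_, g⟩ ⟨y, rfl, hy⟩ ⟨y', rfl, hy'⟩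
        exact ⟨y + y', map_add _ _ _, fun z => by
          simp only [map_add, inner_add_right, hy z, hy' z, Prod.snd_add]⟩
      zero_mem' := ⟨0, by simp, by simp⟩
      smul_mem' := by
        rintro c ⟨_, f⟩ ⟨y, rfl, hy⟩
        exact ⟨c • y, map_smul _ _ _, fun z => by
          simp only [map_smul, inner_smul_right, hy z, Prod.smul_snd]⟩ }
  have hG : ∀ y f, (j y, f) ∈ G ↔ ∀ z, inner ℂ z (S y) = inner ℂ (j z) f := by
    intro y f
    constructor
    · rintro ⟨y', hy, h⟩
      rwa [hj hy] at h
    · exact fun h => ⟨y, rfl, h⟩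
  have hzero : ∀ f : X, (∀ z, inner ℂ (j z) f = 0) → f = 0 := by
    intro f h
    have : (fun x : X => inner ℂ x f) = fun _ => (0 : ℂ) :=
      hd.equalizer (by fun_prop) continuous_const (funext h)
    exact inner_self_eq_zero.1 (congrFun this f)
  have hfun : ∀ x ∈ G, x.1 = 0 → x.2 = 0 := by
    rintro ⟨_, f⟩ ⟨y, rfl, h⟩ h0
    obtain rfl : y = 0 := hj (h0.trans (map_zero j).symm)
    exact hzero f fun z => by simpa using (h z).symm
  have hgraph := G.toLinearPMap_graph_eq hfun
  have hdom : ∀ x : G.toLinearPMap.domain, ∃ y, j y = x ∧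
      ∀ z, inner ℂ z (S y) = inner ℂ (j z) (G.toLinearPMap x) :=
    fun x => G.mem_graph_toLinearPMap hfun x
  -- the resolvent
  let A : Y →L[ℂ] Y := S + (K : ℂ) • (ContinuousLinearMap.adjoint j).comp j
  have hA : ∀ z y, inner ℂ z (A y) = inner ℂ z (S y) + K * inner ℂ (j z) (j y) := by
    intro z y
    simp [A, ContinuousLinearMap.adjoint_inner_right]
  have hself : ∀ y, inner ℂ (j y) (j y) = ((‖j y‖ ^ 2 : ℝ) : ℂ) := fun y => by
    rw [inner_self_eq_norm_sq_to_K]; norm_cast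
  -- This is Lax–Milgram: the hypothesis `hc` says exactly that A = S + K j*j is bounded below by κ
  -- in the quadratic form sense.
  have hAunit : IsUnit A := by
    refine ContinuousLinearMap.isUnit_of_forall_le_norm_inner_map A (c := ⟨κ, hκ.le⟩) hκ
      fun y => ?_
    rw [norm_inner_symm, mul_comm]
    refine (hc y).trans (le_trans (le_of_eq ?_) (Complex.re_le_norm _))
    rw [hA, hself, Complex.add_re, Complex.re_ofReal_mul, Complex.ofReal_re]
  have hAsurj : ∀ w, ∃ y, A y = w := by
    intro w
    obtain ⟨u, hu⟩ := hAunit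
    refine ⟨(↑u⁻¹ : Y →L[ℂ] Y) w, ?_⟩
    rw [← hu, ← mul_apply_eq_comp]
    simp
  -- Solving A y = j* f amounts to (H + K)(j y) = f, so H + K is onto.
  have hres : ∀ f : X, ∃ y, (j y, f - (K : ℂ) • j y) ∈ G ∧
      A y = ContinuousLinearMap.adjoint j f := by
    intro f
    obtain ⟨y, hy⟩ := hAsurj (ContinuousLinearMap.adjoint j f)
    refine ⟨y, (hG _ _).2 fun z => ?_, hy⟩
    have := hA z y
    rw [hy, ContinuousLinearMap.adjoint_inner_right] at this
    rw [inner_sub_right, inner_smul_right, this]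
    ring
  have hsurj : ∀ f : X, ∃ x : G.toLinearPMap.domain, G.toLinearPMap x + (K : ℂ) • (x : X) = f := by
    intro f
    obtain ⟨y, hy, -⟩ := hres f
    rw [← hgraph, LinearPMap.mem_graph_iff] at hy
    obtain ⟨x, hx, hx'⟩ := hy
    exact ⟨x, by rw [hx, hx']; simp⟩
  have hdense : Dense (G.toLinearPMap.domain : Set X) := by
    rw [Submodule.dense_iff_topologicalClosure_eq_top, Submodule.topologicalClosure_eq_top_iff,
      Submodule.eq_bot_iff]
    intro f hf
    obtain ⟨y, hy, hAy⟩ := hres f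
    -- `f` is orthogonal to the domain, hence to `j y`, so the form vanishes at `y`
    have h1 : inner ℂ (j y) f = 0 :=
      hf _ ⟨(j y, f - (K : ℂ) • j y), hy, rfl⟩
    have h2 : κ * ‖y‖ ^ 2 ≤ 0 := by
      refine (hc y).trans (le_of_eq ?_)
      have h3 := hA y y
      rw [hAy, ContinuousLinearMap.adjoint_inner_right, h1, hself] at h3
      have h4 := congrArg Complex.re h3
      rw [Complex.add_re, Complex.re_ofReal_mul, Complex.ofReal_re] at h4
      exact h4.symm
    have h5 : y = 0 := by
      have : ‖y‖ ^ 2 = 0 := le_antisymm (by nlinarith) (sq_nonneg _)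
      simpa using this
    refine hzero f fun z => ?_
    rw [← ContinuousLinearMap.adjoint_inner_right, ← hAy, h5, map_zero, inner_zero_right]
  refine ⟨G.toLinearPMap, fun x f => ?_, ?_⟩
  · rw [hgraph]
    constructor
    · rintro ⟨y, rfl, h⟩
      refine ⟨⟨y, rfl⟩, fun z => ?_⟩
      obtain ⟨z, rfl⟩ := mk_surjective z
      exact (form_mk z y).trans (h z)
    · rintro ⟨⟨y, rfl⟩, h⟩
      exact ⟨y, rfl, fun z => (form_mk (hj := hj) z y).symm.trans (h (mk hj S z))⟩
  · refine LinearPMap.isSelfAdjoint_of_surjective hdense (fun x y => ?_) K hsurj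
    obtain ⟨u, hu, hu'⟩ := hdom x
    obtain ⟨v, hv, hv'⟩ := hdom y
    have h1 := hv' u
    have h2 := hu' v
    rw [hu] at h1
    rw [hv] at h2
    change inner ℂ (G.toLinearPMap x) (y : X) = inner ℂ (x : X) (G.toLinearPMap y)
    rw [← h1, ← inner_conj_symm, ← h2, inner_conj_symm, hS]

end EmbeddedForm

/-! ### Primitives and weak derivatives on an interval -/

section Interval

variable {ℓ : ℝ}

theorem IntervalL2.integrable (f : IntervalL2 ℓ) : Integrable f (volume.restrict (Ioo 0 ℓ)) :=
  (Lp.memLp f).integrable (by norm_num)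

/-- The indicator function of `(0, x)` in `L²(0, ℓ)`. -/
noncomputable def intervalInd (ℓ x : ℝ) : IntervalL2 ℓ :=
  indicatorConstLp 2 (measurableSet_Iic : MeasurableSet (Iic x)) (measure_ne_top _ _) 1

/-- The primitive of `g` that vanishes at `0`. -/
noncomputable def primFun (g : IntervalL2 ℓ) (x : ℝ) : ℂ := inner ℂ (intervalInd ℓ x) g

theorem primFun_eq_integral (g : IntervalL2 ℓ) (x : ℝ) :
    primFun g x = ∫ s in Iic x, g s ∂(volume.restrict (Ioo 0 ℓ)) :=
  L2.inner_indicatorConstLp_one _ _ _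

theorem continuous_primFun (g : IntervalL2 ℓ) : Continuous (primFun g) := by
  have h : primFun g = fun x => (∫ s in Iic 0, g s ∂(volume.restrict (Ioo 0 ℓ))) +
      ∫ s in (0 : ℝ)..x, g s ∂(volume.restrict (Ioo 0 ℓ)) := by
    funext x
    rw [← intervalIntegral.integral_Iic_sub_Iic g.integrable.integrableOn
      g.integrable.integrableOn, primFun_eq_integral]
    ring
  rw [h]
  exact continuous_const.add
    (intervalIntegral.continuous_primitive (fun a b => g.integrable.intervalIntegrable) 0)

theorem norm_primFun_le (g : IntervalL2 ℓ) (x : ℝ) :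
    ‖primFun g x‖ ≤ (volume.restrict (Ioo 0 ℓ)).real univ ^ (2⁻¹ : ℝ) * ‖g‖ := by
  refine (norm_inner_le_norm _ _).trans ?_
  gcongr
  rw [intervalInd, norm_indicatorConstLp (by norm_num) (by norm_num)]
  simp only [norm_one, one_mul, ENNReal.toReal_ofNat, one_div]
  gcongr
  exacts [measure_ne_top _ _, subset_univ _]

theorem memLp_primFun (g : IntervalL2 ℓ) : MemLp (primFun g) 2 (volume.restrict (Ioo 0 ℓ)) :=
  MemLp.of_bound (continuous_primFun g).aestronglyMeasurable _
    (ae_of_all _ (norm_primFun_le g))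

/-- The integration operator on `L²(0, ℓ)`. -/
noncomputable def primL (ℓ : ℝ) : IntervalL2 ℓ →L[ℂ] IntervalL2 ℓ :=
  LinearMap.mkContinuous
    { toFun := fun g => (memLp_primFun g).toLp
      map_add' := fun f g => by
        rw [← MemLp.toLp_add]
        congr 1
        funext x
        exact inner_add_right _ _ _
      map_smul' := fun c g => by
        rw [RingHom.id_apply, ← MemLp.toLp_const_smul]
        congr 1
        funext x
        exact inner_smul_right _ _ _ }
    ((measureUnivNNReal (volume.restrict (Ioo 0 ℓ)) : ℝ) ^ (2 : ENNReal).toReal⁻¹ *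
      (volume.restrict (Ioo 0 ℓ)).real univ ^ (2⁻¹ : ℝ))
    (fun g => by
      rw [mul_assoc]
      refine Lp.norm_le_of_ae_bound (by positivity) ?_
      filter_upwards [(memLp_primFun g).coeFn_toLp] with x hx
      change ‖(memLp_primFun g).toLp _ x‖ ≤ _
      rw [hx]
      exact norm_primFun_le g x)

theorem coeFn_primL (g : IntervalL2 ℓ) :
    primL ℓ g =ᵐ[volume.restrict (Ioo 0 ℓ)] primFun g :=
  (memLp_primFun g).coeFn_toLp

theorem intervalInd_length_ae : intervalInd ℓ ℓ =ᵐ[volume.restrict (Ioo 0 ℓ)] fun _ => 1 := by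
  filter_upwards [indicatorConstLp_coeFn (p := 2) (hs := (measurableSet_Iic : MeasurableSet (Iic ℓ)))
    (hμs := measure_ne_top (volume.restrict (Ioo 0 ℓ)) _) (c := (1 : ℂ)),
    ae_restrict_mem measurableSet_Ioo] with x hx hx'
  exact hx.trans (indicator_of_mem (mem_Iic.2 hx'.2.le) _)

theorem primFun_length (g : IntervalL2 ℓ) : primFun g ℓ = ∫ s in Ioo 0 ℓ, g s := by
  rw [primFun_eq_integral, Measure.restrict_restrict measurableSet_Iic,
    inter_eq_right.2 fun x hx => hx.2.le]

theorem primFun_zero (g : IntervalL2 ℓ) : primFun g 0 = 0 := by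
  rw [primFun_eq_integral, Measure.restrict_restrict measurableSet_Iic,
    show Iic 0 ∩ Ioo 0 ℓ = ∅ from by ext x; simp; intro h1 h2; linarith]
  simp

/-- The function `c + ∫₀ˣ g` in `L²(0, ℓ)`. -/
noncomputable def prim (c : ℂ) (g : IntervalL2 ℓ) : IntervalL2 ℓ :=
  c • intervalInd ℓ ℓ + primL ℓ g

theorem coeFn_prim (c : ℂ) (g : IntervalL2 ℓ) :
    prim c g =ᵐ[volume.restrict (Ioo 0 ℓ)] fun x => c + primFun g x := by
  filter_upwards [Lp.coeFn_add (c • intervalInd ℓ ℓ) (primL ℓ g),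
    Lp.coeFn_smul c (intervalInd ℓ ℓ), coeFn_primL g, intervalInd_length_ae] with x h1 h2 h3 h4
  rw [prim, h1, Pi.add_apply, h2, Pi.smul_apply, h3, h4, smul_eq_mul, mul_one]

/-- Integration by parts for integrable functions, by Fubini. -/
theorem integral_primitive_mul_add {μ : Measure ℝ} [SFinite μ] [NullSingletonClass μ] {f g : ℝ → ℂ}
    (hf : Integrable f μ) (hg : Integrable g μ) :
    ∫ t, (∫ s in Iic t, f s ∂μ) * g t ∂μ + ∫ t, f t * (∫ s in Iic t, g s ∂μ) ∂μ =
      (∫ t, f t ∂μ) * ∫ t, g t ∂μ := by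
  have hfg : Integrable (fun p : ℝ × ℝ => f p.2 * g p.1) (μ.prod μ) := by
    simpa only [mul_comm] using hg.mul_prod hf
  have hm1 : MeasurableSet {p : ℝ × ℝ | p.2 ≤ p.1} := measurableSet_le measurable_snd measurable_fst
  have hm2 : MeasurableSet {p : ℝ × ℝ | p.1 ≤ p.2} := measurableSet_le measurable_fst measurable_snd
  have h1 : ∫ t, (∫ s in Iic t, f s ∂μ) * g t ∂μ =
      ∫ t, ∫ s, {p : ℝ × ℝ | p.2 ≤ p.1}.indicator (fun p => f p.2 * g p.1) (t, s) ∂μ ∂μ := by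
    congr 1 with t
    rw [← integral_mul_const, ← integral_indicator measurableSet_Iic]
    rfl
  have h2 : ∫ t, f t * (∫ s in Iic t, g s ∂μ) ∂μ =
      ∫ t, ∫ s, {p : ℝ × ℝ | p.1 ≤ p.2}.indicator (fun p => f p.2 * g p.1) (t, s) ∂μ ∂μ := by
    rw [integral_integral_swap (f := fun t s => {p : ℝ × ℝ | p.1 ≤ p.2}.indicator
      (fun p => f p.2 * g p.1) (t, s)) (hfg.indicator hm2)]
    congr 1 with t
    rw [← integral_const_mul, ← integral_indicator measurableSet_Iic]
    rfl
  rw [h1, h2, ← integral_prod _ (hfg.indicator hm1), ← integral_prod _ (hfg.indicator hm2),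
    ← integral_add' (hfg.indicator hm1) (hfg.indicator hm2), mul_comm, ← integral_prod_mul,
    integral_prod _ ((hfg.indicator hm1).add (hfg.indicator hm2)),
    integral_prod _ (hg.mul_prod hf)]
  congr 1 with t
  refine integral_congr_ae ?_
  -- The triangles s ≤ t and t ≤ s cover the square and overlap only on the diagonal, which is null
  -- because μ has no atoms.
  have : ∀ᵐ s ∂μ, s ≠ t := by
    rw [ae_iff]; simp
  filter_upwards [this] with s hs
  rcases lt_or_gt_of_ne hs with h | h
  · simp [indicator, h.le, h.not_ge, mul_comm]
  · simp [indicator, h.le, h.not_ge, mul_comm]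

/-- The Fubini identity is applied to the conjugate of f and to g. It exhibits integration as
skew-adjoint up to a rank-one boundary term, and all later integrations by parts come from it. -/
theorem inner_primL_add (f g : IntervalL2 ℓ) :
    inner ℂ (primL ℓ f) g + inner ℂ f (primL ℓ g) = conj (primFun f ℓ) * primFun g ℓ := by
  have key := integral_primitive_mul_add (μ := volume.restrict (Ioo 0 ℓ))
    (f := fun x => conj (f x)) (g := g)
    ((LinearIsometryEquiv.integrable_comp_iff Complex.conjLIE).2 f.integrable) g.integrable
  rw [primFun_length, primFun_length, ← integral_conj, ← key, L2.inner_def, L2.inner_def]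
  congr 1
  · refine integral_congr_ae ?_
    filter_upwards [coeFn_primL f] with x hx
    rw [hx, primFun_eq_integral, integral_conj, RCLike.inner_apply, mul_comm]
  · refine integral_congr_ae ?_
    filter_upwards [coeFn_primL g] with x hx
    rw [hx, primFun_eq_integral, RCLike.inner_apply, mul_comm]

theorem inner_intervalInd_length (g : IntervalL2 ℓ) :
    inner ℂ (intervalInd ℓ ℓ) g = primFun g ℓ := rfl

/-- Integration by parts. -/
theorem inner_prim_add (c d : ℂ) (f g : IntervalL2 ℓ) :
    inner ℂ f (prim d g) + inner ℂ (prim c f) g =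
      conj (c + primFun f ℓ) * (d + primFun g ℓ) - conj c * d := by
  have h := inner_primL_add f g
  have h1 : inner ℂ f (intervalInd ℓ ℓ) = conj (primFun f ℓ) := by
    rw [← inner_conj_symm]; rfl
  rw [prim, prim, inner_add_right, inner_add_left, inner_smul_left, inner_smul_right, h1,
    inner_intervalInd_length, map_add]
  linear_combination h

/-- A test function is the primitive of its own derivative, whose total integral is zero. In the
Fubini identity for φ' and g the boundary product therefore vanishes, and so does the contribution
of the constant c. -/
theorem hasWeakDeriv_prim (hℓ : 0 < ℓ) (c : ℂ) (g : IntervalL2 ℓ) :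
    HasWeakDeriv (prim c g) g := by
  intro φ hφ hcs hsupp
  have hφ' : Continuous (deriv φ) := hφ.continuous_deriv (by simp)
  have hdf : Integrable (fun x => ((deriv φ x : ℝ) : ℂ)) (volume.restrict (Ioo 0 ℓ)) :=
    ((hφ'.integrable_of_hasCompactSupport hcs.deriv).ofReal).restrict
  have hnot : ∀ x, x ∉ Ioo 0 ℓ → φ x = 0 := fun x hx =>
    image_eq_zero_of_notMem_tsupport fun h => hx (hsupp h)
  have h0 : φ 0 = 0 := hnot 0 (by simp)
  have hl : φ ℓ = 0 := hnot ℓ (by simp)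
  have hprim : ∀ x ∈ Icc 0 ℓ, ∫ s in Iic x, ((deriv φ s : ℝ) : ℂ) ∂(volume.restrict (Ioo 0 ℓ)) =
      φ x := by
    intro x hx
    have h1 : (Iic x ∩ Ioo 0 ℓ : Set ℝ) =ᵐ[volume] Ioc 0 x := by
      have h2 : (Iic x ∩ Ioc 0 ℓ : Set ℝ) = Ioc 0 x := by
        ext y
        simp only [mem_inter_iff, mem_Iic, mem_Ioc]
        constructor
        · rintro ⟨a, b, c⟩; exact ⟨b, a⟩
        · rintro ⟨a, b⟩; exact ⟨b, a, b.trans hx.2⟩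
      rw [← h2]
      exact ae_eq_set_inter (ae_eq_refl _) Ioo_ae_eq_Ioc
    rw [Measure.restrict_restrict measurableSet_Iic, setIntegral_congr_set h1, integral_complex_ofReal,
      ← intervalIntegral.integral_of_le hx.1, intervalIntegral.integral_deriv_eq_sub
        (fun y _ => (hφ.differentiable (by simp)).differentiableAt)
        (hφ'.intervalIntegrable _ _), h0, sub_zero]
  have htot : ∫ s, ((deriv φ s : ℝ) : ℂ) ∂(volume.restrict (Ioo 0 ℓ)) = 0 := by
    have := hprim ℓ ⟨hℓ.le, le_rfl⟩
    rwa [Measure.restrict_restrict measurableSet_Iic, inter_eq_right.2 fun x hx => hx.2.le, hl,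
      Complex.ofReal_zero] at this
  have key := integral_primitive_mul_add hdf g.integrable
  rw [htot, zero_mul] at key
  have h1 : ∫ x in Ioo 0 ℓ, deriv φ x • prim c g x =
      ∫ x in Ioo 0 ℓ, ((deriv φ x : ℝ) : ℂ) * ∫ s in Iic x, g s ∂(volume.restrict (Ioo 0 ℓ)) := by
    have h2 : ∫ x in Ioo 0 ℓ, deriv φ x • prim c g x =
        ∫ x in Ioo 0 ℓ, ((deriv φ x : ℝ) : ℂ) * c + ((deriv φ x : ℝ) : ℂ) * primFun g x := by
      refine integral_congr_ae ?_
      filter_upwards [coeFn_prim c g] with x hx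
      rw [hx, Complex.real_smul, mul_add]
    rw [h2, integral_add (hdf.mul_const c), integral_mul_const, htot, zero_mul, zero_add]
    · simp only [primFun_eq_integral]
    · exact hdf.mul_bdd (continuous_primFun g).aestronglyMeasurable
        (ae_of_all _ (norm_primFun_le g))
  have h3 : ∫ x in Ioo 0 ℓ, φ x • g x =
      ∫ x in Ioo 0 ℓ, (∫ s in Iic x, ((deriv φ s : ℝ) : ℂ) ∂(volume.restrict (Ioo 0 ℓ))) * g x := by
    refine setIntegral_congr_fun measurableSet_Ioo fun x hx => ?_
    rw [hprim x (Ioo_subset_Icc_self hx), Complex.real_smul]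
  rw [h1, h3]
  linear_combination key

theorem HasWeakDeriv.sub {f f' g g' : IntervalL2 ℓ} (hf : HasWeakDeriv f f')
    (hg : HasWeakDeriv g g') : HasWeakDeriv (f - g) (f' - g') := by
  intro φ hφ hcs hsupp
  have hint : ∀ (ψ : ℝ → ℝ), Continuous ψ → HasCompactSupport ψ → ∀ u v : IntervalL2 ℓ,
      ∫ x in Ioo 0 ℓ, ψ x • (u - v) x =
        (∫ x in Ioo 0 ℓ, ψ x • u x) - ∫ x in Ioo 0 ℓ, ψ x • v x := by
    intro ψ hψ hψc u v
    obtain ⟨C, hC⟩ := hψ.bounded_above_of_compact_support hψc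
    have hi (u : IntervalL2 ℓ) : Integrable (fun x => ψ x • u x) (volume.restrict (Ioo 0 ℓ)) :=
      u.integrable.bdd_smul C hψ.aestronglyMeasurable (ae_of_all _ hC)
    rw [← integral_sub (hi u) (hi v)]
    refine integral_congr_ae ?_
    filter_upwards [Lp.coeFn_sub u v] with x hx
    rw [hx, Pi.sub_apply, smul_sub]
  rw [hint _ (hφ.continuous_deriv (by simp)) hcs.deriv, hint _ hφ.continuous hcs,
    hf φ hφ hcs hsupp, hg φ hφ hcs hsupp]
  ring

theorem IntervalL2.eq_zero_of_integral_smul_eq_zero {f : IntervalL2 ℓ}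
    (h : ∀ φ : ℝ → ℝ, ContDiff ℝ ∞ φ → HasCompactSupport φ → tsupport φ ⊆ Ioo 0 ℓ →
      ∫ x in Ioo 0 ℓ, φ x • f x = 0) : f = 0 := by
  have h1 := isOpen_Ioo.ae_eq_zero_of_integral_contDiff_smul_eq_zero (μ := volume)
    (U := Ioo 0 ℓ) (f := f)
    (IntegrableOn.locallyIntegrableOn f.integrable) (fun φ hφ hcs hsupp => by
      rw [← h φ hφ hcs hsupp, setIntegral_eq_integral_of_forall_compl_eq_zero]
      intro x hx
      rw [image_eq_zero_of_notMem_tsupport fun h => hx (hsupp h), zero_smul])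
  refine Lp.ext ?_
  filter_upwards [(ae_restrict_iff' measurableSet_Ioo).2 h1, Lp.coeFn_zero ℂ 2 (volume.restrict (Ioo 0 ℓ))] with x hx hx'
  rw [hx, hx', Pi.zero_apply]

theorem HasWeakDeriv.unique {f g g' : IntervalL2 ℓ} (hg : HasWeakDeriv f g)
    (hg' : HasWeakDeriv f g') : g = g' := by
  rw [← sub_eq_zero]
  refine IntervalL2.eq_zero_of_integral_smul_eq_zero fun φ hφ hcs hsupp => ?_
  have h := hg.sub hg' φ hφ hcs hsupp
  have h0 : ∫ x in Ioo 0 ℓ, deriv φ x • (f - f) x = 0 := by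
    rw [← integral_zero ℝ ℂ (μ := volume.restrict (Ioo 0 ℓ))]
    refine integral_congr_ae ?_
    filter_upwards [Lp.coeFn_sub f f] with x hx
    rw [hx]; simp
  rw [h0] at h
  simpa using h.symm

end Interval

/-! ### Sobolev functions on an interval as iterated primitives -/

section Interval

variable {ℓ : ℝ}

/-- A test function on `(0, ℓ)` with vanishing integral is the derivative of a test function. -/
theorem exists_deriv_eq_of_integral_eq_zero {φ : ℝ → ℝ} (hφ : ContDiff ℝ ∞ φ)
    (hcs : HasCompactSupport φ) (hsupp : tsupport φ ⊆ Ioo 0 ℓ) (hint : ∫ x, φ x = 0) :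
    ∃ ψ : ℝ → ℝ, ContDiff ℝ ∞ ψ ∧ HasCompactSupport ψ ∧ tsupport ψ ⊆ Ioo 0 ℓ ∧ deriv ψ = φ := by
  rcases (tsupport φ).eq_empty_or_nonempty with he | hne
  · refine ⟨0, contDiff_const, HasCompactSupport.zero, by simp [tsupport], ?_⟩
    rw [tsupport_eq_empty_iff.1 he]
    exact deriv_const' 0
  obtain ⟨a, ha, hle⟩ := hcs.isCompact.exists_isLeast hne
  obtain ⟨b, hb, hge⟩ := hcs.isCompact.exists_isGreatest hne
  have hzero : ∀ x, x ∉ Icc a b → φ x = 0 := fun x hx =>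
    image_eq_zero_of_notMem_tsupport fun h => hx ⟨hle h, hge h⟩
  have hderiv : ∀ x, HasDerivAt (fun y => ∫ s in a..y, φ s) (φ x) x := fun x =>
    hφ.continuous.integral_hasStrictDerivAt a x |>.hasDerivAt
  have hd : deriv (fun y => ∫ s in a..y, φ s) = φ := funext fun x => (hderiv x).deriv
  have hvanish : ∀ x, x ∉ Icc a b → ∫ s in a..x, φ s = 0 := by
    intro x hx
    rcases lt_or_ge x a with h | h
    · refine intervalIntegral.integral_zero_ae (ae_of_all _ fun s hs => ?_)
      rw [uIoc_of_ge h.le] at hs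
      rcases hs.2.lt_or_eq with h1 | h1
      · exact hzero s fun h2 => absurd h2.1 (not_le.2 h1)
      -- The endpoint s = a belongs to the support interval, so `hzero` does not apply; φ a = 0
      -- follows by continuity from the left.
      · have : ∀ᶠ t in 𝓝[<] a, φ t = 0 := by
          filter_upwards [self_mem_nhdsWithin] with t ht
          exact hzero t fun h2 => absurd h2.1 (not_le.2 ht)
        rw [h1]
        exact tendsto_nhds_unique (hφ.continuous.continuousWithinAt (s := Iio a) (x := a))
          (tendsto_const_nhds.congr' (this.mono fun t ht => ht.symm))
    · have hbx : b < x := not_le.1 fun h2 => hx ⟨h, h2⟩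
      rw [intervalIntegral.integral_of_le h, ← integral_Icc_eq_integral_Ioc,
        setIntegral_eq_integral_of_forall_compl_eq_zero, hint]
      intro s hs
      exact hzero s fun h2 => hs ⟨h2.1, h2.2.trans hbx.le⟩
  have hts : tsupport (fun y => ∫ s in a..y, φ s) ⊆ Icc a b :=
    closure_minimal (fun x hx => by_contra fun h => hx (hvanish x h)) isClosed_Icc
  refine ⟨fun y => ∫ s in a..y, φ s, ?_, ?_, ?_, hd⟩
  · rw [contDiff_infty_iff_deriv, hd]
    exact ⟨fun x => (hderiv x).differentiableAt, hφ⟩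
  · exact isCompact_Icc.of_isClosed_subset (isClosed_tsupport _) hts
  · exact hts.trans fun x hx => ⟨(hsupp ha).1.trans_le hx.1, hx.2.trans_lt (hsupp hb).2⟩

theorem exists_testFunction_integral_eq_one (hℓ : 0 < ℓ) :
    ∃ ρ : ℝ → ℝ, ContDiff ℝ ∞ ρ ∧ HasCompactSupport ρ ∧ tsupport ρ ⊆ Ioo 0 ℓ ∧ ∫ x, ρ x = 1 := by
  let ρ : ContDiffBump (ℓ / 2) := ⟨ℓ / 8, ℓ / 4, by positivity, by linarith⟩
  refine ⟨ρ.normed volume, ρ.contDiff_normed, ρ.hasCompactSupport_normed, ?_, ρ.integral_normed⟩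
  rw [ρ.tsupport_normed_eq, Real.closedBall_eq_Icc]
  intro x hx
  have h1 : ℓ / 2 - ℓ / 4 ≤ x := hx.1
  have h2 : x ≤ ℓ / 2 + ℓ / 4 := hx.2
  constructor <;> linarith

/-- The lemma of du Bois-Reymond. -/
theorem HasWeakDeriv.eq_const_of_zero (hℓ : 0 < ℓ) {f : IntervalL2 ℓ} (hf : HasWeakDeriv f 0) :
    ∃ c : ℂ, f = c • intervalInd ℓ ℓ := by
  obtain ⟨ρ, hρ, hρc, hρs, hρ1⟩ := exists_testFunction_integral_eq_one hℓ
  have hi : ∀ {ψ : ℝ → ℝ}, Continuous ψ → HasCompactSupport ψ →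
      Integrable (fun x => ψ x • f x) (volume.restrict (Ioo 0 ℓ)) := by
    intro ψ hψ hψc
    obtain ⟨C, hC⟩ := hψ.bounded_above_of_compact_support hψc
    exact f.integrable.bdd_smul C hψ.aestronglyMeasurable (ae_of_all _ hC)
  -- If f is constant, its value must be its average against ρ, which has integral 1.
  set c : ℂ := ∫ x in Ioo 0 ℓ, ρ x • f x with hc
  refine ⟨c, ?_⟩
  rw [← sub_eq_zero]
  refine IntervalL2.eq_zero_of_integral_smul_eq_zero fun φ hφ hφc hφs => ?_
  have hφi : Integrable φ := hφ.continuous.integrable_of_hasCompactSupport hφc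
  have hρi : Integrable ρ := hρ.continuous.integrable_of_hasCompactSupport hρc
  -- Subtracting m ρ leaves a test function of mean zero, hence the derivative of a test function,
  -- on which f integrates to zero.
  set m : ℝ := ∫ x, φ x with hm
  have hcs' : HasCompactSupport (fun x => φ x - m * ρ x) := hφc.sub (hρc.mul_left)
  obtain ⟨ψ, hψ, hψc, hψs, hψd⟩ := exists_deriv_eq_of_integral_eq_zero (ℓ := ℓ)
    (φ := fun x => φ x - m * ρ x) (hφ.sub (contDiff_const.mul hρ)) hcs'
    (by
      refine (tsupport_sub φ fun x => m * ρ x).trans (union_subset hφs ?_)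
      exact (closure_mono (Function.support_mul_subset_right _ _)).trans hρs)
    (by rw [integral_sub hφi (hρi.const_mul m), integral_const_mul, hρ1, mul_one, sub_self])
  have h1 := hf ψ hψ hψc hψs
  have h2 : ∫ x in Ioo 0 ℓ, ψ x • (0 : IntervalL2 ℓ) x = 0 := by
    rw [← integral_zero ℝ ℂ (μ := volume.restrict (Ioo 0 ℓ))]
    refine integral_congr_ae ?_
    filter_upwards [Lp.coeFn_zero ℂ 2 (volume.restrict (Ioo 0 ℓ))] with x hx
    rw [hx]; simp
  rw [h2, neg_zero, hψd] at h1
  have h3 : ∫ x in Ioo 0 ℓ, (φ x - m * ρ x) • f x = (∫ x in Ioo 0 ℓ, φ x • f x) - m • c := by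
    rw [hc, ← integral_smul, ← integral_sub (g := fun x => m • ρ x • f x) (hi hφ.continuous hφc)
      ((hi hρ.continuous hρc).smul m)]
    simp only [sub_smul, mul_smul]
  have h4 : ∫ x in Ioo 0 ℓ, φ x = m := by
    rw [setIntegral_eq_integral_of_forall_compl_eq_zero]
    exact fun x hx => image_eq_zero_of_notMem_tsupport fun h => hx (hφs h)
  have h5 : ∫ x in Ioo 0 ℓ, φ x • (f - c • intervalInd ℓ ℓ) x =
      (∫ x in Ioo 0 ℓ, φ x • f x) - ∫ x in Ioo 0 ℓ, φ x • c := by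
    rw [← integral_sub (hi hφ.continuous hφc) (hφi.restrict.smul_const c)]
    refine integral_congr_ae ?_
    filter_upwards [Lp.coeFn_sub f (c • intervalInd ℓ ℓ), Lp.coeFn_smul c (intervalInd ℓ ℓ),
      intervalInd_length_ae (ℓ := ℓ)] with x h1 h2 h3
    rw [h1, Pi.sub_apply, h2, Pi.smul_apply, h3, smul_sub, smul_eq_mul, mul_one]
  rw [h5, integral_smul_const, h4, ← h3, h1]

/-- Since f and the primitive of g have the same weak derivative, du Bois-Reymond says that they
differ by a constant. This normal form replaces all further arguments with test functions. -/
theorem HasWeakDeriv.exists_eq_prim (hℓ : 0 < ℓ) {f g : IntervalL2 ℓ} (h : HasWeakDeriv f g) :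
    ∃ c, f = prim c g := by
  have h1 := h.sub (hasWeakDeriv_prim hℓ 0 g)
  rw [sub_self] at h1
  obtain ⟨c, hc⟩ := h1.eq_const_of_zero hℓ
  refine ⟨c, ?_⟩
  rw [prim, zero_smul, zero_add, sub_eq_iff_eq_add] at hc
  exact hc

theorem HasWeakDeriv.weakDeriv_eq {f g : IntervalL2 ℓ} (h : HasWeakDeriv f g) :
    weakDeriv f = g := by
  have hex : ∃ g, HasWeakDeriv f g := ⟨g, h⟩
  rw [weakDeriv, dif_pos hex]
  exact hex.choose_spec.unique h

theorem weakDeriv_prim (hℓ : 0 < ℓ) (c : ℂ) (g : IntervalL2 ℓ) : weakDeriv (prim c g) = g :=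
  (hasWeakDeriv_prim hℓ c g).weakDeriv_eq

/-- The representative chosen by `contValue` is arbitrary, but continuous functions that agree
almost everywhere agree on the closed interval, ends included. -/
theorem contValue_prim (hℓ : 0 < ℓ) (c : ℂ) (g : IntervalL2 ℓ) {x : ℝ} (hx : x ∈ Icc 0 ℓ) :
    contValue (prim c g) x = c + primFun g x := by
  have hcont : Continuous fun x => c + primFun g x := continuous_const.add (continuous_primFun g)
  have hex : ∃ u : ℝ → ℂ, ContinuousOn u (Icc 0 ℓ) ∧
      prim c g =ᵐ[volume.restrict (Ioo (0 : ℝ) ℓ)] u :=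
    ⟨fun x => c + primFun g x, hcont.continuousOn, coeFn_prim c g⟩
  rw [contValue, dif_pos hex]
  obtain ⟨h1, h2⟩ := hex.choose_spec
  have h3 : hex.choose =ᵐ[volume.restrict (Icc 0 ℓ)] fun x => c + primFun g x := by
    rw [← restrict_Ioo_eq_restrict_Icc]
    exact h2.symm.trans (coeFn_prim c g)
  exact Measure.eqOn_Icc_of_ae_eq volume hℓ.ne h3 h1 hcont.continuousOn hx

theorem contValue_prim_zero (hℓ : 0 < ℓ) (c : ℂ) (g : IntervalL2 ℓ) :
    contValue (prim c g) 0 = c := by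
  rw [contValue_prim hℓ c g ⟨le_rfl, hℓ.le⟩, primFun_zero, add_zero]

theorem contValue_prim_length (hℓ : 0 < ℓ) (c : ℂ) (g : IntervalL2 ℓ) :
    contValue (prim c g) ℓ = c + primFun g ℓ :=
  contValue_prim hℓ c g ⟨hℓ.le, le_rfl⟩

theorem prim_injective (hℓ : 0 < ℓ) {c d : ℂ} {f g : IntervalL2 ℓ} (h : prim c f = prim d g) :
    c = d ∧ f = g := by
  constructor
  · rw [← contValue_prim_zero hℓ c f, h, contValue_prim_zero hℓ]
  · rw [← weakDeriv_prim hℓ c f, h, weakDeriv_prim hℓ]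

theorem memSobolev_prim_iff (hℓ : 0 < ℓ) (k : ℕ) (c : ℂ) (g : IntervalL2 ℓ) :
    MemSobolev (k + 1) (prim c g) ↔ MemSobolev k g := by
  constructor
  · rintro ⟨g', h, h'⟩
    rwa [h.unique (hasWeakDeriv_prim hℓ c g)] at h'
  · exact fun h => ⟨g, hasWeakDeriv_prim hℓ c g, h⟩

theorem memSobolev_succ_iff (hℓ : 0 < ℓ) (k : ℕ) (f : IntervalL2 ℓ) :
    MemSobolev (k + 1) f ↔ ∃ c g, f = prim c g ∧ MemSobolev k g := by
  constructor
  · rintro ⟨g, h, hg⟩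
    obtain ⟨c, rfl⟩ := h.exists_eq_prim hℓ
    exact ⟨c, g, rfl, hg⟩
  · rintro ⟨c, g, rfl, hg⟩
    exact (memSobolev_prim_iff hℓ k c g).2 hg

theorem weakDerivN_zero (f : IntervalL2 ℓ) : weakDerivN 0 f = f := rfl

theorem weakDerivN_prim (hℓ : 0 < ℓ) (k : ℕ) (c : ℂ) (g : IntervalL2 ℓ) :
    weakDerivN (k + 1) (prim c g) = weakDerivN k g := by
  rw [weakDerivN, Function.iterate_succ_apply, weakDeriv_prim hℓ]
  rfl

theorem smul_prim (k c : ℂ) (g : IntervalL2 ℓ) : k • prim c g = prim (k * c) (k • g) := by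
  rw [prim, prim, smul_add, mul_smul, map_smul]

/-- Integration by parts for functions in `H¹`. -/
theorem inner_weakDeriv_add (hℓ : 0 < ℓ) {f g : IntervalL2 ℓ} (hf : MemSobolev 1 f)
    (hg : MemSobolev 1 g) :
    inner ℂ (weakDeriv f) g + inner ℂ f (weakDeriv g) =
      conj (contValue f ℓ) * contValue g ℓ - conj (contValue f 0) * contValue g 0 := by
  obtain ⟨c, f, rfl, -⟩ := (memSobolev_succ_iff hℓ 0 _).1 hf
  obtain ⟨d, g, rfl, -⟩ := (memSobolev_succ_iff hℓ 0 _).1 hg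
  rw [weakDeriv_prim hℓ, weakDeriv_prim hℓ, inner_prim_add, contValue_prim_length hℓ,
    contValue_prim_length hℓ, contValue_prim_zero hℓ, contValue_prim_zero hℓ]

end Interval

/-! ### Weak Euler–Lagrange equations and prescribed end values on an interval -/

section Interval

variable {ℓ : ℝ}

theorem prim_zero_zero : prim 0 (0 : IntervalL2 ℓ) = 0 := by simp [prim]

theorem prim_zero_right (c : ℂ) : prim c (0 : IntervalL2 ℓ) = c • intervalInd ℓ ℓ := by simp [prim]

theorem prim_zero_left (g : IntervalL2 ℓ) : prim 0 g = primL ℓ g := by simp [prim]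

theorem primFun_add (f g : IntervalL2 ℓ) (x : ℝ) : primFun (f + g) x = primFun f x + primFun g x :=
  inner_add_right _ _ _

theorem primFun_smul (c : ℂ) (g : IntervalL2 ℓ) (x : ℝ) : primFun (c • g) x = c * primFun g x :=
  inner_smul_right _ _ _

/-- The end value of a double primitive becomes a pairing of g with fixed vectors, the constant
function 1 and its primitive. Vanishing end data is thus orthogonality to a two-dimensional space.
-/
theorem primFun_primL_length (g : IntervalL2 ℓ) :
    primFun (primL ℓ g) ℓ = conj (primFun (intervalInd ℓ ℓ) ℓ) * primFun g ℓ -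
      inner ℂ (primL ℓ (intervalInd ℓ ℓ)) g := by
  rw [← inner_primL_add]
  exact (add_sub_cancel_left _ _).symm

theorem intervalInd_ne_zero (hℓ : 0 < ℓ) : intervalInd ℓ ℓ ≠ 0 := by
  intro h
  have h1 : prim 1 (0 : IntervalL2 ℓ) = prim 0 0 := by rw [prim_zero_right, h, prim_zero_zero]; simp
  exact one_ne_zero (prim_injective hℓ h1).1

theorem primL_intervalInd_ne_smul (hℓ : 0 < ℓ) (c : ℂ) :
    primL ℓ (intervalInd ℓ ℓ) ≠ c • intervalInd ℓ ℓ := by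
  rw [← prim_zero_left, ← prim_zero_right]
  exact fun h => intervalInd_ne_zero hℓ (prim_injective hℓ h).2

/-- Weak form of `-G' = f`. -/
theorem exists_eq_prim_of_inner_eq {G f : IntervalL2 ℓ}
    (h : ∀ g : IntervalL2 ℓ, primFun g ℓ = 0 → inner ℂ g G = inner ℂ (prim 0 g) f) :
    ∃ d, G = prim d (-f) := by
  -- Admissible g are those orthogonal to the constants, so G + ∫f lies in the double orthogonal
  -- complement of the constants, which is their span.
  have hmem : G + primL ℓ f ∈ (Submodule.span ℂ {intervalInd ℓ ℓ})ᗮᗮ := by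
    rw [Submodule.mem_orthogonal]
    intro g hg
    have h0 : primFun g ℓ = 0 := Submodule.mem_orthogonal_singleton_iff_inner_right.1 hg
    have h1 := inner_primL_add g f
    rw [h0, map_zero, zero_mul] at h1
    rw [inner_add_right, h g h0, prim_zero_left, h1]
  rw [Submodule.orthogonal_orthogonal, Submodule.mem_span_singleton] at hmem
  obtain ⟨d, hd⟩ := hmem
  exact ⟨d, by rw [prim, hd, map_neg]; simp⟩

/-- Weak form of `G'' = f`. -/
theorem exists_eq_prim_prim_of_inner_eq {G f : IntervalL2 ℓ}
    (h : ∀ g : IntervalL2 ℓ, primFun g ℓ = 0 → primFun (prim 0 g) ℓ = 0 →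
      inner ℂ g G = inner ℂ (prim 0 (prim 0 g)) f) :
    ∃ d₀ d₁, G = prim d₀ (prim d₁ f) := by
  -- Here admissible g are orthogonal to the functions 1 and x. Two integrations by parts without
  -- boundary terms show that G − ∬f lies in their span.
  have hmem : G - primL ℓ (primL ℓ f) ∈
      (Submodule.span ℂ {intervalInd ℓ ℓ, primL ℓ (intervalInd ℓ ℓ)})ᗮᗮ := by
    rw [Submodule.mem_orthogonal]
    intro g hg
    rw [Submodule.mem_orthogonal] at hg
    have h0 : primFun g ℓ = 0 := hg _ (Submodule.subset_span (by simp))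
    have h1 : inner ℂ (primL ℓ (intervalInd ℓ ℓ)) g = 0 := hg _ (Submodule.subset_span (by simp))
    have h2 : primFun (primL ℓ g) ℓ = 0 := by rw [primFun_primL_length, h0, h1]; simp
    have h3 := inner_primL_add g (primL ℓ f)
    have h4 := inner_primL_add (primL ℓ g) f
    rw [h0, map_zero, zero_mul] at h3
    rw [h2, map_zero, zero_mul] at h4
    rw [inner_sub_right, h g h0 (by rwa [prim_zero_left]), prim_zero_left, prim_zero_left]
    linear_combination h4 - h3
  have : FiniteDimensional ℂ
      (Submodule.span ℂ {intervalInd ℓ ℓ, primL ℓ (intervalInd ℓ ℓ)}) :=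
    FiniteDimensional.span_of_finite ℂ (toFinite _)
  rw [Submodule.orthogonal_orthogonal, Submodule.mem_span_pair] at hmem
  obtain ⟨d₀, d₁, hd⟩ := hmem
  refine ⟨d₀, d₁, ?_⟩
  rw [prim, prim, map_add, map_smul, ← add_assoc, hd]
  simp

/-- Gram–Schmidt: the component w of v orthogonal to u is nonzero, so the pairing with u is adjusted
along u and the pairing with v is then corrected along w. -/
theorem exists_inner_eq_inner_eq {X : Type*} [NormedAddCommGroup X] [InnerProductSpace ℂ X]
    {u v : X} (hu : u ≠ 0) (hv : ∀ c : ℂ, v ≠ c • u) (a b : ℂ) :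
    ∃ g : X, inner ℂ u g = a ∧ inner ℂ v g = b := by
  have huu : inner ℂ u u ≠ 0 := inner_self_ne_zero.2 hu
  set k : ℂ := inner ℂ u v / inner ℂ u u with hk
  set w : X := v - k • u with hw
  have hw0 : w ≠ 0 := sub_ne_zero.2 (hv k)
  have huw : inner ℂ u w = 0 := by
    rw [hw, inner_sub_right, inner_smul_right, hk, div_mul_cancel₀ _ huu, sub_self]
  have hvw : inner ℂ v w = inner ℂ w w := by
    conv_rhs => rw [hw, inner_sub_left, inner_smul_left, ← hw, huw, mul_zero, sub_zero]
  have hww : inner ℂ w w ≠ 0 := inner_self_ne_zero.2 hw0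
  refine ⟨(a / inner ℂ u u) • u + ((b - a / inner ℂ u u * inner ℂ v u) / inner ℂ w w) • w, ?_, ?_⟩
  · rw [inner_add_right, inner_smul_right, inner_smul_right, huw]
    field_simp
    ring
  · rw [inner_add_right, inner_smul_right, inner_smul_right, hvw, div_mul_cancel₀ _ hww]
    ring

theorem exists_primFun_eq (hℓ : 0 < ℓ) (a : ℂ) : ∃ g : IntervalL2 ℓ, primFun g ℓ = a := by
  obtain ⟨g, hg, -⟩ := exists_inner_eq_inner_eq (intervalInd_ne_zero hℓ)
    (primL_intervalInd_ne_smul hℓ) a 0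
  exact ⟨g, hg⟩

/-- Both end values are affine in the pairings of g with 1 and with its primitive. These two vectors
are linearly independent, so the end values are independent too. -/
theorem exists_primFun_eq_primFun_prim_eq (hℓ : 0 < ℓ) (c a b : ℂ) :
    ∃ g : IntervalL2 ℓ, primFun g ℓ = a ∧ primFun (prim c g) ℓ = b := by
  obtain ⟨g, hg, hg'⟩ := exists_inner_eq_inner_eq (intervalInd_ne_zero hℓ)
    (primL_intervalInd_ne_smul hℓ) a
    (c * primFun (intervalInd ℓ ℓ) ℓ + conj (primFun (intervalInd ℓ ℓ) ℓ) * a - b)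
  refine ⟨g, hg, ?_⟩
  rw [inner_intervalInd_length] at hg
  rw [prim, primFun_add, primFun_smul, primFun_primL_length, hg', hg]
  ring

end Interval

/-! ### Vectors of `ℂ³` -/

namespace BeamFrame

variable {V E : Type*} (Γ : BeamFrame V E)

theorem inner_toC3 (x y : EuclideanSpace ℝ (Fin 3)) :
    inner ℂ (toC3 x) (toC3 y) = ((inner ℝ x y : ℝ) : ℂ) := by
  simp [toC3, PiLp.inner_apply]

theorem orthonormal_toC3 (e : E) :
    Orthonormal ℂ ![toC3 (Γ.i e), toC3 (Γ.j e), toC3 (Γ.k e)] := by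
  have h := orthonormal_iff_ite.1 (Γ.orthonormal e)
  rw [orthonormal_iff_ite]
  intro m n
  have hv (m : Fin 3) : ![toC3 (Γ.i e), toC3 (Γ.j e), toC3 (Γ.k e)] m =
      toC3 (![Γ.i e, Γ.j e, Γ.k e] m) := by
    fin_cases m <;> rfl
  rw [hv, hv, inner_toC3, h m n]
  split_ifs <;> simp

/-- The vector with coordinates `x, y, z` in the material basis of the beam `e`. -/
noncomputable def vec (e : E) (x y z : ℂ) : EuclideanSpace ℂ (Fin 3) :=
  x • toC3 (Γ.i e) + y • toC3 (Γ.j e) + z • toC3 (Γ.k e)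

theorem inner_vec (e : E) (x y z x' y' z' : ℂ) :
    inner ℂ (Γ.vec e x y z) (Γ.vec e x' y' z') = conj x * x' + conj y * y' + conj z * z' := by
  have h := orthonormal_iff_ite.1 (Γ.orthonormal_toC3 e)
  have h00 := h 0 0
  have h01 := h 0 1
  have h02 := h 0 2
  have h10 := h 1 0
  have h11 := h 1 1
  have h12 := h 1 2
  have h20 := h 2 0
  have h21 := h 2 1
  have h22 := h 2 2
  simp only [Matrix.cons_val_zero, Matrix.cons_val_one, Matrix.cons_val, Fin.isValue] at *
  simp only [vec, inner_add_left, inner_add_right, inner_smul_left, inner_smul_right, h00, h01,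
    h02, h10, h11, h12, h20, h21, h22]
  simp
  ring

theorem vec_surjective (e : E) (γ : EuclideanSpace ℂ (Fin 3)) : ∃ x y z, Γ.vec e x y z = γ := by
  let b := basisOfOrthonormalOfCardEqFinrank (Γ.orthonormal_toC3 e) (by simp)
  refine ⟨b.repr γ 0, b.repr γ 1, b.repr γ 2, ?_⟩
  conv_rhs => rw [← b.sum_repr γ]
  simp [Fin.sum_univ_three, b, vec]

theorem vec_eq_zero_iff (e : E) (x y z : ℂ) : Γ.vec e x y z = 0 ↔ x = 0 ∧ y = 0 ∧ z = 0 := by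
  constructor
  · intro h
    have h1 := Γ.inner_vec e 1 0 0 x y z
    have h2 := Γ.inner_vec e 0 1 0 x y z
    have h3 := Γ.inner_vec e 0 0 1 x y z
    simp only [h, inner_zero_right] at h1 h2 h3
    simp at h1 h2 h3
    exact ⟨h1.symm, h2.symm, h3.symm⟩
  · rintro ⟨rfl, rfl, rfl⟩
    simp [vec]

theorem disp_eq_vec (Ψ : Γ.State) (e : E) (x : V) :
    Γ.disp Ψ e x = Γ.vec e (Γ.val Ψ e .u 0 x) (Γ.val Ψ e .w 0 x) (Γ.val Ψ e .v 0 x) := rfl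

theorem rot_eq_vec (Ψ : Γ.State) (e : E) (x : V) :
    Γ.rot Ψ e x = Γ.vec e (Γ.val Ψ e .η 0 x) (-Γ.val Ψ e .v 1 x) (Γ.val Ψ e .w 1 x) := by
  rw [rot, vec, neg_smul, sub_eq_add_neg]

/-- The force exerted by the beam `e` at the joint `x`, up to sign. -/
noncomputable def beamForce (Ψ : Γ.State) (e : E) (x : V) : EuclideanSpace ℂ (Fin 3) :=
  Γ.vec e (Γ.c e * Γ.val Ψ e .u 1 x) (-(Γ.b e * Γ.val Ψ e .w 3 x)) (-(Γ.a e * Γ.val Ψ e .v 3 x))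

/-- The moment exerted by the beam `e` at the joint `x`, up to sign. -/
noncomputable def beamMoment (Ψ : Γ.State) (e : E) (x : V) : EuclideanSpace ℂ (Fin 3) :=
  Γ.vec e (Γ.d e * Γ.val Ψ e .η 1 x) (-(Γ.a e * Γ.val Ψ e .v 2 x)) (Γ.b e * Γ.val Ψ e .w 2 x)

theorem force_eq [Fintype E] (Ψ : Γ.State) (x : V) :
    Γ.force Ψ x = ∑ e, Γ.sign x e • Γ.beamForce Ψ e x := by
  simp only [force, beamForce, vec, neg_smul, sub_eq_add_neg]

theorem moment_eq [Fintype E] (Ψ : Γ.State) (x : V) :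
    Γ.moment Ψ x = ∑ e, Γ.sign x e • Γ.beamMoment Ψ e x := by
  simp only [moment, beamMoment, vec, neg_smul, sub_eq_add_neg]

/-! ### Special joints -/

theorem sign_eq_zero {e : E} {x : V} (h : ¬ Γ.Incident e x) : Γ.sign x e = 0 := by
  rw [Incident, not_or] at h
  rw [sign, if_neg h.1, if_neg h.2]

theorem sign_ne_zero {e : E} {x : V} (h : Γ.Incident e x) : Γ.sign x e ≠ 0 := by
  rw [sign]
  split_ifs with h1 h2
  · exact one_ne_zero
  · exact neg_ne_zero.2 one_ne_zero
  · exact absurd h (not_or.2 ⟨h1, h2⟩)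

theorem jointDisp_eq {Ψ : Γ.State} {x : V} (h : Γ.DispContinuousAt Ψ x) {e : E}
    (he : Γ.Incident e x) : Γ.jointDisp Ψ x = Γ.disp Ψ e x := by
  have hex : ∃ e, Γ.Incident e x := ⟨e, he⟩
  rw [jointDisp, dif_pos hex]
  exact h _ _ hex.choose_spec he

theorem jointRot_eq {Ψ : Γ.State} {x : V} (h : Γ.RotContinuousAt Ψ x) {e : E}
    (he : Γ.Incident e x) : Γ.jointRot Ψ x = Γ.rot Ψ e x := by
  have hex : ∃ e, Γ.Incident e x := ⟨e, he⟩
  rw [jointRot, dif_pos hex]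
  exact h _ _ hex.choose_spec he

/-- At a joint without beams both sides hold, because the joint displacement is 0 there by
convention. -/
theorem dispContinuousAt_and_jointDisp_eq_zero_iff (Ψ : Γ.State) (x : V) :
    Γ.DispContinuousAt Ψ x ∧ Γ.jointDisp Ψ x = 0 ↔ ∀ e, Γ.Incident e x → Γ.disp Ψ e x = 0 := by
  constructor
  · rintro ⟨h, h0⟩ e he
    rw [← Γ.jointDisp_eq h he, h0]
  · intro h
    refine ⟨fun e e' he he' => by rw [h e he, h e' he'], ?_⟩
    rw [jointDisp]
    split_ifs with hex
    · exact h _ hex.choose_spec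
    · rfl

theorem rotContinuousAt_and_jointRot_eq_zero_iff (Ψ : Γ.State) (x : V) :
    Γ.RotContinuousAt Ψ x ∧ Γ.jointRot Ψ x = 0 ↔ ∀ e, Γ.Incident e x → Γ.rot Ψ e x = 0 := by
  constructor
  · rintro ⟨h, h0⟩ e he
    rw [← Γ.jointRot_eq h he, h0]
  · intro h
    refine ⟨fun e e' he he' => by rw [h e he, h e' he'], ?_⟩
    rw [jointRot]
    split_ifs with hex
    · exact h _ hex.choose_spec
    · rfl

section SpecialJoints

variable [Fintype E] {α β : V → ℝ} (Ψ : Γ.State) {x : V}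

theorem vertexConditions_free (hα : α x = 0) (hβ : β x = 0) : Γ.VertexConditions α β Ψ x ↔
    Γ.DispContinuousAt Ψ x ∧ Γ.RotContinuousAt Ψ x ∧ Γ.force Ψ x = 0 ∧ Γ.moment Ψ x = 0 := by
  simp [VertexConditions, hα, hβ]

theorem vertexConditions_clamped (hα : α x = Real.pi / 2) (hβ : β x = Real.pi / 2) :
    Γ.VertexConditions α β Ψ x ↔
      (∀ e, Γ.Incident e x → Γ.disp Ψ e x = 0) ∧ ∀ e, Γ.Incident e x → Γ.rot Ψ e x = 0 := by
  rw [← dispContinuousAt_and_jointDisp_eq_zero_iff, ← rotContinuousAt_and_jointRot_eq_zero_iff]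
  simp only [VertexConditions, hα, hβ, Real.sin_pi_div_two, Real.cos_pi_div_two, one_smul,
    zero_smul, add_zero]
  tauto

theorem vertexConditions_pinned (hα : α x = Real.pi / 2) (hβ : β x = 0) :
    Γ.VertexConditions α β Ψ x ↔ (∀ e, Γ.Incident e x → Γ.disp Ψ e x = 0) ∧
      Γ.RotContinuousAt Ψ x ∧ Γ.moment Ψ x = 0 := by
  rw [← dispContinuousAt_and_jointDisp_eq_zero_iff]
  simp only [VertexConditions, hα, hβ, Real.sin_pi_div_two, Real.cos_pi_div_two, one_smul,
    zero_smul, add_zero, Real.sin_zero, Real.cos_zero, zero_add]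
  tauto

theorem vertexConditions_guided (hα : α x = 0) (hβ : β x = Real.pi / 2) :
    Γ.VertexConditions α β Ψ x ↔ (∀ e, Γ.Incident e x → Γ.rot Ψ e x = 0) ∧
      Γ.DispContinuousAt Ψ x ∧ Γ.force Ψ x = 0 := by
  rw [← rotContinuousAt_and_jointRot_eq_zero_iff]
  simp only [VertexConditions, hα, hβ, Real.sin_pi_div_two, Real.cos_pi_div_two, one_smul,
    zero_smul, add_zero, Real.sin_zero, Real.cos_zero, zero_add]
  tauto

end SpecialJoints

section DegreeOne

variable (Ψ : Γ.State) {x : V} {e : E} (hx : ∀ e', Γ.Incident e' x ↔ e' = e)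
include hx

theorem dispContinuousAt_of_unique : Γ.DispContinuousAt Ψ x := by
  intro e₁ e₂ h₁ h₂
  rw [(hx _).1 h₁, (hx _).1 h₂]

theorem rotContinuousAt_of_unique : Γ.RotContinuousAt Ψ x := by
  intro e₁ e₂ h₁ h₂
  rw [(hx _).1 h₁, (hx _).1 h₂]

theorem forall_disp_eq_zero_iff_of_unique : (∀ e', Γ.Incident e' x → Γ.disp Ψ e' x = 0) ↔
    Γ.val Ψ e .u 0 x = 0 ∧ Γ.val Ψ e .w 0 x = 0 ∧ Γ.val Ψ e .v 0 x = 0 := by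
  simp only [hx, forall_eq, disp_eq_vec, vec_eq_zero_iff]

theorem forall_rot_eq_zero_iff_of_unique : (∀ e', Γ.Incident e' x → Γ.rot Ψ e' x = 0) ↔
    Γ.val Ψ e .η 0 x = 0 ∧ Γ.val Ψ e .v 1 x = 0 ∧ Γ.val Ψ e .w 1 x = 0 := by
  simp only [hx, forall_eq, rot_eq_vec, vec_eq_zero_iff, neg_eq_zero]

theorem sum_sign_smul_of_unique [Fintype E] (f : E → EuclideanSpace ℂ (Fin 3)) :
    ∑ e', Γ.sign x e' • f e' = Γ.sign x e • f e := by
  refine Finset.sum_eq_single e (fun e' _ h => ?_) (by simp)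
  rw [Γ.sign_eq_zero fun h' => h ((hx e').1 h'), zero_smul]

theorem force_eq_zero_iff_of_unique [Fintype E] : Γ.force Ψ x = 0 ↔
    Γ.val Ψ e .u 1 x = 0 ∧ Γ.val Ψ e .w 3 x = 0 ∧ Γ.val Ψ e .v 3 x = 0 := by
  rw [force_eq, Γ.sum_sign_smul_of_unique hx,
    smul_eq_zero_iff_right (Γ.sign_ne_zero ((hx e).2 rfl)), beamForce, vec_eq_zero_iff]
  simp [(Γ.a_pos e).ne', (Γ.b_pos e).ne', (Γ.c_pos e).ne']

theorem moment_eq_zero_iff_of_unique [Fintype E] : Γ.moment Ψ x = 0 ↔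
    Γ.val Ψ e .η 1 x = 0 ∧ Γ.val Ψ e .v 2 x = 0 ∧ Γ.val Ψ e .w 2 x = 0 := by
  rw [moment_eq, Γ.sum_sign_smul_of_unique hx,
    smul_eq_zero_iff_right (Γ.sign_ne_zero ((hx e).2 rfl)), beamMoment, vec_eq_zero_iff]
  simp [(Γ.a_pos e).ne', (Γ.b_pos e).ne', (Γ.d_pos e).ne']

end DegreeOne

end BeamFrame

/-! ### Parametrization of the form domain by initial values and top derivatives -/

/-- Whether the energy of the field involves second derivatives. -/
def Field4.bending : Field4 → Bool
  | .v | .w => true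
  | .u | .η => false

/-- The order of the derivatives of the field in the energy. -/
def Field4.order : Field4 → ℕ
  | .v | .w => 2
  | .u | .η => 1

namespace BeamFrame

variable {V E : Type*} (Γ : BeamFrame V E)

theorem coord_mem (x : V) (e : E) : Γ.coord x e ∈ Icc 0 (Γ.length e) := by
  have := (Γ.length_pos e).le
  rw [coord]
  split_ifs <;> simp [this]

/-- The stiffness of a field. -/
def stiffness (p : E × Field4) : ℝ :=
  match p.2 with
  | .v => Γ.a p.1
  | .w => Γ.b p.1
  | .u => Γ.c p.1
  | .η => Γ.d p.1

theorem stiffness_pos (p : E × Field4) : 0 < Γ.stiffness p := by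
  obtain ⟨e, F⟩ := p
  cases F
  exacts [Γ.a_pos e, Γ.b_pos e, Γ.c_pos e, Γ.d_pos e]

/-- The derivative of a field that enters the energy. -/
noncomputable def topDeriv (Ψ : Γ.State) (p : E × Field4) : IntervalL2 (Γ.length p.1) :=
  weakDerivN p.2.order (Ψ p)

/-- Initial values and top derivatives of all fields on all beams. -/
abbrev Param : Type _ := WithLp 2 (EuclideanSpace ℂ (E × Field4 × Fin 2) × Γ.State)

/-- An initial value. -/
noncomputable def initL (i : E × Field4 × Fin 2) : Γ.Param →L[ℂ] ℂ :=
  (EuclideanSpace.proj i).comp (WithLp.fstL 2 ℂ _ _)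

/-- A top derivative. -/
noncomputable def topL (p : E × Field4) : Γ.Param →L[ℂ] IntervalL2 (Γ.length p.1) :=
  (PiLp.proj 2 (fun p : E × Field4 => IntervalL2 (Γ.length p.1)) p).comp (WithLp.sndL 2 ℂ _ _)

theorem norm_sq_param [Fintype E] (y : Γ.Param) :
    ‖y‖ ^ 2 = ∑ i, ‖Γ.initL i y‖ ^ 2 + ∑ p, ‖Γ.topL p y‖ ^ 2 := by
  rw [WithLp.prod_norm_sq_eq_of_L2, EuclideanSpace.norm_sq_eq, PiLp.norm_sq_eq_of_L2]
  rfl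

/-- The first derivative of the fields `v`, `w` and `u`, `η`. -/
noncomputable def midL (p : E × Field4) : Γ.Param →L[ℂ] IntervalL2 (Γ.length p.1) :=
  if p.2.bending then
    (Γ.initL (p.1, p.2, 1)).smulRight (intervalInd (Γ.length p.1) (Γ.length p.1)) +
      (primL _).comp (Γ.topL p)
  else Γ.topL p

/-- The fields. -/
noncomputable def fieldL (p : E × Field4) : Γ.Param →L[ℂ] IntervalL2 (Γ.length p.1) :=
  (Γ.initL (p.1, p.2, 0)).smulRight (intervalInd (Γ.length p.1) (Γ.length p.1)) +
    (primL _).comp (Γ.midL p)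

/-- The state with given initial values and top derivatives. -/
noncomputable def embL : Γ.Param →L[ℂ] Γ.State :=
  (PiLp.continuousLinearEquiv 2 ℂ fun p : E × Field4 => IntervalL2 (Γ.length p.1)).symm.toContinuousLinearMap.comp
    (ContinuousLinearMap.pi Γ.fieldL)

theorem embL_apply (y : Γ.Param) (p : E × Field4) : Γ.embL y p = Γ.fieldL p y := rfl

theorem fieldL_apply (y : Γ.Param) (p : E × Field4) :
    Γ.fieldL p y = prim (Γ.initL (p.1, p.2, 0) y) (Γ.midL p y) := rfl

theorem midL_of_bending (y : Γ.Param) {p : E × Field4} (hp : p.2.bending = true) :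
    Γ.midL p y = prim (Γ.initL (p.1, p.2, 1) y) (Γ.topL p y) := by
  rw [midL, if_pos hp]
  rfl

theorem midL_of_not_bending (y : Γ.Param) {p : E × Field4} (hp : p.2.bending = false) :
    Γ.midL p y = Γ.topL p y := by
  rw [midL, hp, if_neg (by simp)]

theorem embL_bending (y : Γ.Param) {p : E × Field4} (hp : p.2.bending = true) :
    Γ.embL y p = prim (Γ.initL (p.1, p.2, 0) y) (prim (Γ.initL (p.1, p.2, 1) y) (Γ.topL p y)) := by
  rw [embL_apply, fieldL_apply, Γ.midL_of_bending y hp]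

theorem embL_not_bending (y : Γ.Param) {p : E × Field4} (hp : p.2.bending = false) :
    Γ.embL y p = prim (Γ.initL (p.1, p.2, 0) y) (Γ.topL p y) := by
  rw [embL_apply, fieldL_apply, Γ.midL_of_not_bending y hp]

theorem topDeriv_embL (y : Γ.Param) (p : E × Field4) : Γ.topDeriv (Γ.embL y) p = Γ.topL p y := by
  obtain ⟨e, F⟩ := p
  have := Γ.length_pos e
  cases F
  · exact (congrArg (weakDerivN 2) (Γ.embL_bending y (p := (e, .v)) rfl)).trans
      ((weakDerivN_prim this 1 _ _).trans (weakDerivN_prim this 0 _ _))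
  · exact (congrArg (weakDerivN 2) (Γ.embL_bending y (p := (e, .w)) rfl)).trans
      ((weakDerivN_prim this 1 _ _).trans (weakDerivN_prim this 0 _ _))
  · exact (congrArg (weakDerivN 1) (Γ.embL_not_bending y (p := (e, .u)) rfl)).trans
      (weakDerivN_prim this 0 _ _)
  · exact (congrArg (weakDerivN 1) (Γ.embL_not_bending y (p := (e, .η)) rfl)).trans
      (weakDerivN_prim this 0 _ _)

/-- The value of a field at a joint. -/
noncomputable def valL (p : E × Field4) (x : V) : Γ.Param →L[ℂ] ℂ :=
  Γ.initL (p.1, p.2, 0) +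
    (innerSL ℂ (intervalInd (Γ.length p.1) (Γ.coord x p.1))).comp (Γ.midL p)

/-- The value of the first derivative of `v` or `w` at a joint. -/
noncomputable def slopeL (p : E × Field4) (x : V) : Γ.Param →L[ℂ] ℂ :=
  Γ.initL (p.1, p.2, 1) +
    (innerSL ℂ (intervalInd (Γ.length p.1) (Γ.coord x p.1))).comp (Γ.topL p)

theorem valL_apply (y : Γ.Param) (p : E × Field4) (x : V) :
    Γ.valL p x y = Γ.initL (p.1, p.2, 0) y + primFun (Γ.midL p y) (Γ.coord x p.1) := rfl

theorem slopeL_apply (y : Γ.Param) (p : E × Field4) (x : V) :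
    Γ.slopeL p x y = Γ.initL (p.1, p.2, 1) y + primFun (Γ.topL p y) (Γ.coord x p.1) := rfl

theorem val_embL_zero (y : Γ.Param) (e : E) (F : Field4) (x : V) :
    Γ.val (Γ.embL y) e F 0 x = Γ.valL (e, F) x y := by
  rw [val, weakDerivN_zero, embL_apply, fieldL_apply,
    contValue_prim (Γ.length_pos e) _ _ (Γ.coord_mem x e)]
  rfl

theorem val_embL_one (y : Γ.Param) (e : E) {F : Field4} (hF : F.bending = true) (x : V) :
    Γ.val (Γ.embL y) e F 1 x = Γ.slopeL (e, F) x y := by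
  have h : Γ.embL y (e, F) = _ := Γ.embL_bending y (p := (e, F)) hF
  rw [val, h, weakDerivN_prim (Γ.length_pos e), weakDerivN_zero,
    contValue_prim (Γ.length_pos e) _ _ (Γ.coord_mem x e)]
  rfl

/-- The displacement of a beam at a joint. -/
noncomputable def dispL (e : E) (x : V) : Γ.Param →L[ℂ] EuclideanSpace ℂ (Fin 3) :=
  (Γ.valL (e, .u) x).smulRight (toC3 (Γ.i e)) + (Γ.valL (e, .w) x).smulRight (toC3 (Γ.j e)) +
    (Γ.valL (e, .v) x).smulRight (toC3 (Γ.k e))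

/-- The rotation of a beam at a joint. -/
noncomputable def rotL (e : E) (x : V) : Γ.Param →L[ℂ] EuclideanSpace ℂ (Fin 3) :=
  (Γ.valL (e, .η) x).smulRight (toC3 (Γ.i e)) - (Γ.slopeL (e, .v) x).smulRight (toC3 (Γ.j e)) +
    (Γ.slopeL (e, .w) x).smulRight (toC3 (Γ.k e))

theorem disp_embL (y : Γ.Param) (e : E) (x : V) : Γ.disp (Γ.embL y) e x = Γ.dispL e x y := by
  rw [disp, val_embL_zero, val_embL_zero, val_embL_zero]
  rfl

theorem rot_embL (y : Γ.Param) (e : E) (x : V) : Γ.rot (Γ.embL y) e x = Γ.rotL e x y := by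
  rw [rot, val_embL_zero, val_embL_one _ _ _ rfl, val_embL_one _ _ _ rfl]
  rfl

open Classical in
/-- The displacement of a joint. -/
noncomputable def jointDispL (x : V) : Γ.Param →L[ℂ] EuclideanSpace ℂ (Fin 3) :=
  if h : ∃ e, Γ.Incident e x then Γ.dispL h.choose x else 0

open Classical in
/-- The rotation of a joint. -/
noncomputable def jointRotL (x : V) : Γ.Param →L[ℂ] EuclideanSpace ℂ (Fin 3) :=
  if h : ∃ e, Γ.Incident e x then Γ.rotL h.choose x else 0

theorem jointDisp_embL (y : Γ.Param) (x : V) :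
    Γ.jointDisp (Γ.embL y) x = Γ.jointDispL x y := by
  rw [jointDisp, jointDispL]
  split_ifs with h
  · exact Γ.disp_embL y _ x
  · rfl

theorem jointRot_embL (y : Γ.Param) (x : V) :
    Γ.jointRot (Γ.embL y) x = Γ.jointRotL x y := by
  rw [jointRot, jointRotL]
  split_ifs with h
  · exact Γ.rot_embL y _ x
  · rfl

/-- Rigidity at the joint `x`, with the displacement fixed if `x ∈ P` and the rotation fixed if
`x ∈ Q`. -/
def RigidAt (P Q : Set V) (Ψ : Γ.State) (x : V) : Prop :=
  Γ.DispContinuousAt Ψ x ∧ Γ.RotContinuousAt Ψ x ∧ (x ∈ P → Γ.jointDisp Ψ x = 0) ∧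
    (x ∈ Q → Γ.jointRot Ψ x = 0)

/-- The parameters of the states in the form domain. -/
noncomputable def formParam (P Q : Set V) : Submodule ℂ Γ.Param where
  -- The parameters reserve a slope slot for every field, but `u` and `η` do not use it. Setting it
  -- to zero is what makes the embedding injective.
  carrier := {y | (∀ p : E × Field4, p.2.bending = false → Γ.initL (p.1, p.2, 1) y = 0) ∧
    ∀ x, Γ.RigidAt P Q (Γ.embL y) x}
  zero_mem' := by
    simp [RigidAt, DispContinuousAt, RotContinuousAt, disp_embL, rot_embL, jointDisp_embL,
      jointRot_embL, -map_zero, ContinuousLinearMap.map_zero]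
  add_mem' := by
    simp only [RigidAt, DispContinuousAt, RotContinuousAt, disp_embL, rot_embL, jointDisp_embL,
      jointRot_embL, mem_ofPred_eq]
    rintro y z ⟨hy, hy'⟩ ⟨hz, hz'⟩
    refine ⟨fun p hp => by rw [map_add, hy p hp, hz p hp, add_zero], fun x => ?_⟩
    obtain ⟨h1, h2, h3, h4⟩ := hy' x
    obtain ⟨k1, k2, k3, k4⟩ := hz' x
    refine ⟨fun e e' he he' => ?_, fun e e' he he' => ?_, fun hx => ?_, fun hx => ?_⟩
    · rw [map_add, map_add, h1 e e' he he', k1 e e' he he']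
    · rw [map_add, map_add, h2 e e' he he', k2 e e' he he']
    · rw [map_add, h3 hx, k3 hx, add_zero]
    · rw [map_add, h4 hx, k4 hx, add_zero]
  smul_mem' := by
    simp only [RigidAt, DispContinuousAt, RotContinuousAt, disp_embL, rot_embL, jointDisp_embL,
      jointRot_embL, mem_ofPred_eq]
    rintro c y ⟨hy, hy'⟩
    refine ⟨fun p hp => by rw [map_smul, hy p hp, smul_zero], fun x => ?_⟩
    obtain ⟨h1, h2, h3, h4⟩ := hy' x
    refine ⟨fun e e' he he' => ?_, fun e e' he he' => ?_, fun hx => ?_, fun hx => ?_⟩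
    · rw [map_smul, map_smul, h1 e e' he he']
    · rw [map_smul, map_smul, h2 e e' he he']
    · rw [map_smul, h3 hx, smul_zero]
    · rw [map_smul, h4 hx, smul_zero]

/-- Every defining condition equates bounded linear maps of the parameter. Closedness makes the form
space a Hilbert space. -/
theorem isClosed_formParam (P Q : Set V) : _root_.IsClosed (Γ.formParam P Q : Set Γ.Param) := by
  have h : (Γ.formParam P Q : Set Γ.Param) =
      {y | (∀ p : E × Field4, p.2.bending = false → Γ.initL (p.1, p.2, 1) y = 0) ∧
        ∀ x, Γ.RigidAt P Q (Γ.embL y) x} := rfl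
  rw [h]
  simp only [RigidAt, DispContinuousAt, RotContinuousAt, disp_embL, rot_embL, jointDisp_embL,
    jointRot_embL, ofPred_and, ofPred_forall]
  refine IsClosed.inter (isClosed_iInter fun p => isClosed_iInter fun _ =>
    isClosed_eq (map_continuous _) continuous_const) (isClosed_iInter fun x => ?_)
  refine IsClosed.inter ?_ (IsClosed.inter ?_ (IsClosed.inter ?_ ?_))
  · exact isClosed_iInter fun e => isClosed_iInter fun e' => isClosed_iInter fun _ =>
      isClosed_iInter fun _ => isClosed_eq (map_continuous _) (map_continuous _)
  · exact isClosed_iInter fun e => isClosed_iInter fun e' => isClosed_iInter fun _ =>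
      isClosed_iInter fun _ => isClosed_eq (map_continuous _) (map_continuous _)
  · exact isClosed_iInter fun _ => isClosed_eq (map_continuous _) continuous_const
  · exact isClosed_iInter fun _ => isClosed_eq (map_continuous _) continuous_const

section FormSpace

variable [Fintype E]

/-- The space of parameters of the states in the form domain. -/
def FormSpace (P Q : Set V) : Type _ := Γ.formParam P Q

noncomputable instance (P Q : Set V) : NormedAddCommGroup (Γ.FormSpace P Q) :=
  inferInstanceAs (NormedAddCommGroup (Γ.formParam P Q))

noncomputable instance (P Q : Set V) : InnerProductSpace ℂ (Γ.FormSpace P Q) :=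
  inferInstanceAs (InnerProductSpace ℂ (Γ.formParam P Q))

instance (P Q : Set V) : CompleteSpace (Γ.FormSpace P Q) :=
  (Γ.isClosed_formParam P Q).completeSpace_coe

/-- The inclusion of the parameters of the form domain. -/
noncomputable def incl (P Q : Set V) : Γ.FormSpace P Q →ₗᵢ[ℂ] Γ.Param :=
  (Γ.formParam P Q).subtypeₗᵢ

theorem incl_mem {P Q : Set V} (y : Γ.FormSpace P Q) : Γ.incl P Q y ∈ Γ.formParam P Q :=
  Subtype.property (p := (· ∈ Γ.formParam P Q)) y

theorem exists_incl_eq {P Q : Set V} {y : Γ.Param} (hy : y ∈ Γ.formParam P Q) :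
    ∃ z, Γ.incl P Q z = y :=
  ⟨(⟨y, hy⟩ : Γ.formParam P Q), rfl⟩

/-- The embedding of the form domain. -/
noncomputable def formEmb (P Q : Set V) : Γ.FormSpace P Q →L[ℂ] Γ.State :=
  Γ.embL.comp (Γ.incl P Q).toContinuousLinearMap

theorem formEmb_apply {P Q : Set V} (y : Γ.FormSpace P Q) :
    Γ.formEmb P Q y = Γ.embL (Γ.incl P Q y) := rfl

end FormSpace

theorem param_ext [Fintype E] {y z : Γ.Param} (h : ∀ i, Γ.initL i y = Γ.initL i z)
    (h' : ∀ p, Γ.topL p y = Γ.topL p z) : y = z := by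
  have h0 : ‖y - z‖ ^ 2 = 0 := by
    rw [norm_sq_param]
    simp [h, h']
  rwa [sq_eq_zero_iff, norm_eq_zero, sub_eq_zero] at h0

/-- A primitive determines its constant and its integrand. Peeling off one or two primitives
recovers every coordinate except the unused slope slots, which vanish. -/
theorem formEmb_injective [Fintype E] (P Q : Set V) : Function.Injective (Γ.formEmb P Q) := by
  intro y' z' h
  rw [formEmb_apply, formEmb_apply] at h
  have hy := Γ.incl_mem y'
  have hz := Γ.incl_mem z'
  apply (Γ.incl P Q).injective
  generalize Γ.incl P Q y' = y at h hy ⊢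
  generalize Γ.incl P Q z' = z at h hz ⊢
  have hb : ∀ p : E × Field4, p.2.bending = true → Γ.initL (p.1, p.2, 0) y = Γ.initL (p.1, p.2, 0) z ∧
      Γ.initL (p.1, p.2, 1) y = Γ.initL (p.1, p.2, 1) z ∧ Γ.topL p y = Γ.topL p z := by
    intro p hp
    have h1 : Γ.embL y p = Γ.embL z p := by rw [h]
    rw [Γ.embL_bending y hp, Γ.embL_bending z hp] at h1
    obtain ⟨h2, h3⟩ := prim_injective (Γ.length_pos p.1) h1
    exact ⟨h2, prim_injective (Γ.length_pos p.1) h3⟩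
  have hn : ∀ p : E × Field4, p.2.bending = false → Γ.initL (p.1, p.2, 0) y = Γ.initL (p.1, p.2, 0) z ∧
      Γ.initL (p.1, p.2, 1) y = Γ.initL (p.1, p.2, 1) z ∧ Γ.topL p y = Γ.topL p z := by
    intro p hp
    have h1 : Γ.embL y p = Γ.embL z p := by rw [h]
    rw [Γ.embL_not_bending y hp, Γ.embL_not_bending z hp] at h1
    obtain ⟨h2, h3⟩ := prim_injective (Γ.length_pos p.1) h1
    exact ⟨h2, by rw [hy.1 p hp, hz.1 p hp], h3⟩
  have hall := fun p : E × Field4 => (Bool.eq_false_or_eq_true p.2.bending).elim (hb p) (hn p)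
  refine Γ.param_ext ?_ fun p => (hall p).2.2
  rintro ⟨e, F, i⟩
  fin_cases i
  · exact (hall (e, F)).1
  · exact (hall (e, F)).2.1

/-- A parameter with given components. -/
noncomputable def mkParam (c : E × Field4 × Fin 2 → ℂ)
    (g : ∀ p : E × Field4, IntervalL2 (Γ.length p.1)) : Γ.Param :=
  WithLp.toLp 2 (WithLp.toLp 2 c, WithLp.toLp 2 g)

theorem topL_mkParam (c : E × Field4 × Fin 2 → ℂ)
    (g : ∀ p : E × Field4, IntervalL2 (Γ.length p.1)) (p : E × Field4) :
    Γ.topL p (Γ.mkParam c g) = g p := rfl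

/-- The range of the embedding of the form domain. -/
theorem exists_formEmb_eq_iff [Fintype E] (P Q : Set V) (Ψ : Γ.State) :
    (∃ y, Γ.formEmb P Q y = Ψ) ↔ Γ.MemFormSobolev Ψ ∧ ∀ x, Γ.RigidAt P Q Ψ x := by
  constructor
  · rintro ⟨y', rfl⟩
    rw [formEmb_apply]
    have hy := Γ.incl_mem y'
    generalize Γ.incl P Q y' = y at hy ⊢
    refine ⟨fun e => ?_, hy.2⟩
    have hℓ := Γ.length_pos e
    have hb : ∀ F : Field4, F.bending = true → MemSobolev 2 (Γ.embL y (e, F)) := fun F hF => by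
      rw [Γ.embL_bending y (p := (e, F)) hF]
      exact (memSobolev_prim_iff hℓ _ _ _).2 ((memSobolev_prim_iff hℓ _ _ _).2 trivial)
    have hn : ∀ F : Field4, F.bending = false → MemSobolev 1 (Γ.embL y (e, F)) := fun F hF => by
      rw [Γ.embL_not_bending y (p := (e, F)) hF]
      exact (memSobolev_prim_iff hℓ _ _ _).2 trivial
    exact ⟨hb _ rfl, hb _ rfl, hn _ rfl, hn _ rfl⟩
  · rintro ⟨hS, hR⟩
    have hex : ∀ p : E × Field4, ∃ (c : Fin 2 → ℂ) (g : IntervalL2 (Γ.length p.1)),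
        (p.2.bending = true → Ψ p = prim (c 0) (prim (c 1) g)) ∧
        (p.2.bending = false → c 1 = 0 ∧ Ψ p = prim (c 0) g) := by
      rintro ⟨e, F⟩
      have hℓ := Γ.length_pos e
      obtain ⟨h1, h2, h3, h4⟩ := hS e
      have hb : MemSobolev 2 (Ψ (e, F)) → F.bending = true → ∃ (c : Fin 2 → ℂ)
          (g : IntervalL2 (Γ.length e)), (F.bending = true → Ψ (e, F) = prim (c 0) (prim (c 1) g)) ∧
          (F.bending = false → c 1 = 0 ∧ Ψ (e, F) = prim (c 0) g) := by
        intro h hF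
        obtain ⟨c₀, g, h, h'⟩ := (memSobolev_succ_iff hℓ _ _).1 h
        obtain ⟨c₁, g, rfl, -⟩ := (memSobolev_succ_iff hℓ _ _).1 h'
        exact ⟨![c₀, c₁], g, fun _ => h, by simp [hF]⟩
      have hn : MemSobolev 1 (Ψ (e, F)) → F.bending = false → ∃ (c : Fin 2 → ℂ)
          (g : IntervalL2 (Γ.length e)), (F.bending = true → Ψ (e, F) = prim (c 0) (prim (c 1) g)) ∧
          (F.bending = false → c 1 = 0 ∧ Ψ (e, F) = prim (c 0) g) := by
        intro h hF
        obtain ⟨c₀, g, h, -⟩ := (memSobolev_succ_iff hℓ _ _).1 h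
        exact ⟨![c₀, 0], g, by simp [hF], fun _ => ⟨rfl, h⟩⟩
      cases F
      exacts [hb h1 rfl, hb h2 rfl, hn h3 rfl, hn h4 rfl]
    choose c g hcg using hex
    set y : Γ.Param := Γ.mkParam (fun i => c (i.1, i.2.1) i.2.2) g with hy
    have hemb : Γ.embL y = Ψ := by
      ext1 p
      rcases Bool.eq_false_or_eq_true p.2.bending with hp | hp
      · rw [Γ.embL_bending y hp, (hcg p).1 hp]
        rfl
      · rw [Γ.embL_not_bending y hp, ((hcg p).2 hp).2]
        rfl
    obtain ⟨z, hz⟩ := Γ.exists_incl_eq (P := P) (Q := Q) (y := y)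
      ⟨fun p hp => ((hcg p).2 hp).1, fun x => by rw [hemb]; exact hR x⟩
    exact ⟨z, by rw [formEmb_apply, hz, hemb]⟩

end BeamFrame

/-! ### Green's identity -/

section Interval

variable {ℓ : ℝ}

theorem IntervalL2.real_smul (r : ℝ) (f : IntervalL2 ℓ) : r • f = (r : ℂ) • f := by
  refine Lp.ext ?_
  filter_upwards [Lp.coeFn_smul r f, Lp.coeFn_smul (r : ℂ) f] with x h1 h2
  rw [h1, h2, Pi.smul_apply, Pi.smul_apply, Complex.coe_smul]

theorem MemSobolev.of_succ (hℓ : 0 < ℓ) {k : ℕ} {f : IntervalL2 ℓ} (h : MemSobolev (k + 1) f) :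
    MemSobolev k f := by
  induction k generalizing f with
  | zero => trivial
  | succ k ih =>
    obtain ⟨c, g, rfl, hg⟩ := (memSobolev_succ_iff hℓ _ _).1 h
    exact (memSobolev_prim_iff hℓ _ _ _).2 (ih hg)

theorem MemSobolev.of_le (hℓ : 0 < ℓ) {k m : ℕ} {f : IntervalL2 ℓ} (h : MemSobolev m f)
    (hkm : k ≤ m) : MemSobolev k f := by
  induction m, hkm using Nat.le_induction with
  | base => exact h
  | succ m _ ih => exact ih (h.of_succ hℓ)

theorem MemSobolev.weakDerivN (hℓ : 0 < ℓ) {k : ℕ} (m : ℕ) {f : IntervalL2 ℓ}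
    (h : MemSobolev (k + m) f) : MemSobolev k (weakDerivN m f) := by
  induction m generalizing f with
  | zero => exact h
  | succ m ih =>
    obtain ⟨c, g, rfl, hg⟩ := (memSobolev_succ_iff hℓ _ _).1 h
    rw [weakDerivN_prim hℓ]
    exact ih hg

theorem weakDeriv_weakDerivN (k : ℕ) (f : IntervalL2 ℓ) :
    weakDeriv (weakDerivN k f) = weakDerivN (k + 1) f :=
  (Function.iterate_succ_apply' _ _ _).symm

/-- Green's identity for the second derivative. -/
theorem inner_weakDerivN_one (hℓ : 0 < ℓ) {f g : IntervalL2 ℓ} (hf : MemSobolev 1 f)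
    (hg : MemSobolev 2 g) :
    inner ℂ (weakDerivN 1 f) (weakDerivN 1 g) = -inner ℂ f (weakDerivN 2 g) +
      (conj (contValue f ℓ) * contValue (weakDerivN 1 g) ℓ -
        conj (contValue f 0) * contValue (weakDerivN 1 g) 0) := by
  rw [← inner_weakDeriv_add hℓ hf (hg.weakDerivN hℓ 1), weakDeriv_weakDerivN]
  exact (neg_add_cancel_comm_assoc _ _).symm

/-- Green's identity for the fourth derivative. -/
theorem inner_weakDerivN_two (hℓ : 0 < ℓ) {f g : IntervalL2 ℓ} (hf : MemSobolev 2 f)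
    (hg : MemSobolev 4 g) :
    inner ℂ (weakDerivN 2 f) (weakDerivN 2 g) = inner ℂ f (weakDerivN 4 g) +
      (conj (contValue (weakDerivN 1 f) ℓ) * contValue (weakDerivN 2 g) ℓ -
        conj (contValue (weakDerivN 1 f) 0) * contValue (weakDerivN 2 g) 0) -
      (conj (contValue f ℓ) * contValue (weakDerivN 3 g) ℓ -
        conj (contValue f 0) * contValue (weakDerivN 3 g) 0) := by
  -- Two integrations by parts, for the pairs (f', g'') and (f, g'''), are subtracted so that ⟨f',
  -- g'''⟩ cancels.
  have h1 := inner_weakDeriv_add hℓ (hf.weakDerivN hℓ 1)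
    ((hg.weakDerivN hℓ (k := 2) 2).of_le hℓ one_le_two)
  have h2 := inner_weakDeriv_add hℓ (hf.of_le hℓ one_le_two) (hg.weakDerivN hℓ (k := 1) 3)
  rw [weakDeriv_weakDerivN, weakDeriv_weakDerivN] at h1
  rw [weakDeriv_weakDerivN] at h2
  have h3 : weakDeriv f = weakDerivN 1 f := rfl
  rw [h3] at h2
  linear_combination h1 - h2

end Interval

theorem Field4.sum_univ {M : Type*} [AddCommMonoid M] (f : Field4 → M) :
    ∑ F, f F = f .v + f .w + f .u + f .η := by
  have h : (Finset.univ : Finset Field4) = {.v, .w, .u, .η} := rfl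
  rw [h, Finset.sum_insert (by decide), Finset.sum_insert (by decide),
    Finset.sum_insert (by decide), Finset.sum_singleton, add_assoc, add_assoc]

namespace BeamFrame

variable {V E : Type*} (Γ : BeamFrame V E)

theorem coord_origin (e : E) : Γ.coord (Γ.origin e) e = 0 := by simp [coord]

theorem coord_terminus (e : E) : Γ.coord (Γ.terminus e) e = Γ.length e := by
  simp [coord, Γ.origin_ne_terminus e]

/-- Origin and terminus differ, so each beam contributes exactly two joints. Boundary brackets at
the two ends thereby become sums over joints. -/
theorem sum_sign_mul [Fintype V] (e : E) (h : V → ℂ) :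
    ∑ x, (Γ.sign x e : ℂ) * h x = h (Γ.origin e) - h (Γ.terminus e) := by
  classical
  have h1 : ∀ x, (Γ.sign x e : ℂ) * h x =
      (if Γ.origin e = x then h x else 0) - if Γ.terminus e = x then h x else 0 := by
    intro x
    rw [sign]
    by_cases h1 : Γ.origin e = x
    · have h2 : Γ.terminus e ≠ x := fun h2 => Γ.origin_ne_terminus e (h1.trans h2.symm)
      simp [h1, h2]
    · by_cases h2 : Γ.terminus e = x <;> simp [h1, h2]
  simp only [h1, Finset.sum_sub_distrib, Finset.sum_ite_eq, Finset.mem_univ, if_true]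

/-- The work of the forces and moments of the beam `e` at the joint `x` in `Ψ` along `Φ`. -/
noncomputable def beamWork (Φ Ψ : Γ.State) (e : E) (x : V) : ℂ :=
  inner ℂ (Γ.disp Φ e x) (Γ.beamForce Ψ e x) + inner ℂ (Γ.rot Φ e x) (Γ.beamMoment Ψ e x)

/-- Green's identity for each field leaves a bracket terminus minus origin, the opposite of the
incidence sign. The minus signs in force, moment and rotation are those for which the four brackets
assemble into inner products in the orthonormal beam basis. -/
theorem beam_green [Fintype V] {Φ Ψ f : Γ.State} (hΦ : Γ.MemFormSobolev Φ)
    (hΨ : Γ.MemOpSobolev Ψ) (hf : Γ.IsDiffExpr Ψ f) (e : E) :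
    ∑ F, (Γ.stiffness (e, F) : ℂ) * inner ℂ (Γ.topDeriv Φ (e, F)) (Γ.topDeriv Ψ (e, F)) =
      ∑ F, inner ℂ (Φ (e, F)) (f (e, F)) - ∑ x, (Γ.sign x e : ℂ) * Γ.beamWork Φ Ψ e x := by
  have hℓ := Γ.length_pos e
  obtain ⟨h1, h2, h3, h4⟩ := hΦ e
  obtain ⟨k1, k2, k3, k4⟩ := hΨ e
  obtain ⟨f1, f2, f3, f4⟩ := hf e
  have g1 : inner ℂ (Γ.topDeriv Φ (e, .v)) (Γ.topDeriv Ψ (e, .v)) = _ :=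
    inner_weakDerivN_two hℓ h1 k1
  have g2 : inner ℂ (Γ.topDeriv Φ (e, .w)) (Γ.topDeriv Ψ (e, .w)) = _ :=
    inner_weakDerivN_two hℓ h2 k2
  have g3 : inner ℂ (Γ.topDeriv Φ (e, .u)) (Γ.topDeriv Ψ (e, .u)) = _ :=
    inner_weakDerivN_one hℓ h3 k3
  have g4 : inner ℂ (Γ.topDeriv Φ (e, .η)) (Γ.topDeriv Ψ (e, .η)) = _ :=
    inner_weakDerivN_one hℓ h4 k4
  have hsmul : ∀ (r : ℝ) (φ ψ : IntervalL2 (Γ.length e)),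
      inner ℂ φ (r • ψ) = (r : ℂ) * inner ℂ φ ψ := fun r φ ψ => by
    rw [IntervalL2.real_smul, inner_smul_right]
  rw [Field4.sum_univ, Field4.sum_univ, sum_sign_mul, g1, g2, g3, g4, f1, f2, f3, f4]
  simp only [beamWork, disp_eq_vec, rot_eq_vec, beamForce, beamMoment, inner_vec, val,
    coord_origin, coord_terminus, stiffness, hsmul, inner_neg_right, map_neg, weakDerivN_zero]
  ring

/-- Agreement is needed only on incident beams, since the sign kills the others. This is where
rigidity allows the beam contributions to be summed into total force and moment. -/
theorem inner_sign_sum [Fintype E] (g : EuclideanSpace ℂ (Fin 3)) (x : V)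
    (f : E → EuclideanSpace ℂ (Fin 3)) (g' : E → EuclideanSpace ℂ (Fin 3))
    (h : ∀ e, Γ.Incident e x → g = g' e) :
    ∑ e, (Γ.sign x e : ℂ) * inner ℂ (g' e) (f e) = inner ℂ g (∑ e, Γ.sign x e • f e) := by
  rw [inner_sum]
  refine Finset.sum_congr rfl fun e _ => ?_
  by_cases he : Γ.Incident e x
  · rw [h e he, ← Complex.coe_smul, inner_smul_right]
  · simp [Γ.sign_eq_zero he]

/-- Green's identity on a beam frame. -/
theorem green [Fintype V] [Fintype E] {Φ Ψ f : Γ.State} (hΦ : Γ.MemFormSobolev Φ)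
    (hΦd : ∀ x, Γ.DispContinuousAt Φ x) (hΦr : ∀ x, Γ.RotContinuousAt Φ x)
    (hΨ : Γ.MemOpSobolev Ψ) (hf : Γ.IsDiffExpr Ψ f) :
    ∑ p, (Γ.stiffness p : ℂ) * inner ℂ (Γ.topDeriv Φ p) (Γ.topDeriv Ψ p) =
      inner ℂ Φ f - ∑ x, (inner ℂ (Γ.jointDisp Φ x) (Γ.force Ψ x) +
        inner ℂ (Γ.jointRot Φ x) (Γ.moment Ψ x)) := by
  rw [Fintype.sum_prod_type, PiLp.inner_apply, Fintype.sum_prod_type,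
    Finset.sum_congr rfl fun e _ => Γ.beam_green hΦ hΨ hf e, Finset.sum_sub_distrib,
    Finset.sum_comm (f := fun e x => (Γ.sign x e : ℂ) * Γ.beamWork Φ Ψ e x)]
  refine congrArg₂ (· - ·) rfl (Finset.sum_congr rfl fun x _ => ?_)
  simp only [beamWork, mul_add, Finset.sum_add_distrib]
  rw [force_eq, moment_eq, Γ.inner_sign_sum _ _ _ _ fun e he => Γ.jointDisp_eq (hΦd x) he,
    Γ.inner_sign_sum _ _ _ _ fun e he => Γ.jointRot_eq (hΦr x) he]

theorem IntervalL2.norm_sq_eq {ℓ : ℝ} (f : IntervalL2 ℓ) :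
    ‖f‖ ^ 2 = ∫ x in Ioo 0 ℓ, ‖f x‖ ^ 2 := by
  have h := inner_self_eq_norm_sq_to_K (𝕜 := ℂ) f
  rw [L2.inner_def] at h
  simp only [inner_self_eq_norm_sq_to_K] at h
  have h1 : ((∫ x in Ioo 0 ℓ, ‖f x‖ ^ 2 : ℝ) : ℂ) = ((‖f‖ ^ 2 : ℝ) : ℂ) := by
    rw [← integral_complex_ofReal]
    simpa using h
  exact (Complex.ofReal_injective h1).symm

theorem IntervalL2.integrable_norm_sq {ℓ : ℝ} (f : IntervalL2 ℓ) :
    Integrable (fun x => ‖f x‖ ^ 2) (volume.restrict (Ioo 0 ℓ)) :=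
  (memLp_two_iff_integrable_sq_norm (Lp.memLp f).1).1 (Lp.memLp f)

theorem sum_stiffness_mul_norm_sq [Fintype E] (Ψ : Γ.State) :
    ∑ p, Γ.stiffness p * ‖Γ.topDeriv Ψ p‖ ^ 2 = ∑ e, Γ.beamEnergy Ψ e := by
  rw [Fintype.sum_prod_type]
  refine Finset.sum_congr rfl fun e _ => ?_
  have h (F : Field4) : Integrable (fun x => Γ.stiffness (e, F) * ‖Γ.topDeriv Ψ (e, F) x‖ ^ 2)
      (volume.restrict (Ioo 0 (Γ.length e))) :=
    (IntervalL2.integrable_norm_sq (Γ.topDeriv Ψ (e, F))).const_mul (Γ.stiffness (e, F))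
  have h1 : Γ.beamEnergy Ψ e = ∫ x in Ioo 0 (Γ.length e),
      (Γ.stiffness (e, .v) * ‖Γ.topDeriv Ψ (e, .v) x‖ ^ 2 +
        Γ.stiffness (e, .w) * ‖Γ.topDeriv Ψ (e, .w) x‖ ^ 2 +
        Γ.stiffness (e, .u) * ‖Γ.topDeriv Ψ (e, .u) x‖ ^ 2 +
        Γ.stiffness (e, .η) * ‖Γ.topDeriv Ψ (e, .η) x‖ ^ 2) := rfl
  have hadd (f g : ℝ → ℝ) (hf : Integrable f (volume.restrict (Ioo 0 (Γ.length e))))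
      (hg : Integrable g (volume.restrict (Ioo 0 (Γ.length e)))) :
      Integrable (fun x => f x + g x) (volume.restrict (Ioo 0 (Γ.length e))) := hf.add hg
  rw [Field4.sum_univ, h1, integral_add (hadd _ _ (hadd _ _ (h .v) (h .w)) (h .u)) (h .η),
    integral_add (hadd _ _ (h .v) (h .w)) (h .u), integral_add (h .v) (h .w)]
  simp only [integral_const_mul, IntervalL2.norm_sq_eq]

end BeamFrame

/-! ### The form of a beam frame with elastic or fixed joints -/

namespace BeamFrame

variable {V E : Type*} (Γ : BeamFrame V E)

theorem coord_eq (x : V) (e : E) : Γ.coord x e = 0 ∨ Γ.coord x e = Γ.length e := by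
  rw [coord]
  split_ifs <;> simp

open Classical in
/-- The parameter whose only component is the top derivative `g` of the field `p`. -/
noncomputable def testParam (p : E × Field4) (g : IntervalL2 (Γ.length p.1)) : Γ.Param :=
  Γ.mkParam 0 (Pi.single p g)

theorem initL_testParam (p : E × Field4) (g : IntervalL2 (Γ.length p.1))
    (i : E × Field4 × Fin 2) : Γ.initL i (Γ.testParam p g) = 0 := rfl

open Classical in
theorem topL_testParam_self (p : E × Field4) (g : IntervalL2 (Γ.length p.1)) :
    Γ.topL p (Γ.testParam p g) = g := by
  rw [testParam, topL_mkParam, Pi.single_eq_same]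

open Classical in
theorem topL_testParam_of_ne {p q : E × Field4} (g : IntervalL2 (Γ.length p.1)) (h : q ≠ p) :
    Γ.topL q (Γ.testParam p g) = 0 := by
  rw [testParam, topL_mkParam, Pi.single_eq_of_ne h]

theorem midL_testParam_of_ne {p q : E × Field4} (g : IntervalL2 (Γ.length p.1)) (h : q ≠ p) :
    Γ.midL q (Γ.testParam p g) = 0 := by
  rcases Bool.eq_false_or_eq_true q.2.bending with hq | hq
  · rw [Γ.midL_of_bending _ hq, initL_testParam, Γ.topL_testParam_of_ne g h, prim_zero_zero]
  · rw [Γ.midL_of_not_bending _ hq, Γ.topL_testParam_of_ne g h]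

theorem embL_testParam_of_ne {p q : E × Field4} (g : IntervalL2 (Γ.length p.1)) (h : q ≠ p) :
    Γ.embL (Γ.testParam p g) q = 0 := by
  rw [embL_apply, fieldL_apply, initL_testParam, Γ.midL_testParam_of_ne g h, prim_zero_zero]

theorem primFun_zero_right {ℓ : ℝ} (x : ℝ) : primFun (0 : IntervalL2 ℓ) x = 0 := inner_zero_right _

theorem primFun_coord {e : E} {g : IntervalL2 (Γ.length e)} (hg : primFun g (Γ.length e) = 0)
    (x : V) : primFun g (Γ.coord x e) = 0 := by
  rcases Γ.coord_eq x e with h | h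
  · rw [h, primFun_zero]
  · rw [h, hg]

/-- The field starts at 0 and returns to 0 at the far end, and a joint coordinate is always one of
the two ends. -/
theorem valL_testParam {p : E × Field4} {g : IntervalL2 (Γ.length p.1)}
    (hg : primFun (Γ.midL p (Γ.testParam p g)) (Γ.length p.1) = 0) (q : E × Field4) (x : V) :
    Γ.valL q x (Γ.testParam p g) = 0 := by
  rw [valL_apply, initL_testParam, zero_add]
  by_cases h : q = p
  · subst h
    exact Γ.primFun_coord hg x
  · rw [Γ.midL_testParam_of_ne g h, primFun_zero_right]

theorem slopeL_testParam {p : E × Field4} {g : IntervalL2 (Γ.length p.1)}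
    (hg : primFun g (Γ.length p.1) = 0) (q : E × Field4) (x : V) :
    Γ.slopeL q x (Γ.testParam p g) = 0 := by
  rw [slopeL_apply, initL_testParam, zero_add]
  by_cases h : q = p
  · subst h
    rw [topL_testParam_self]
    exact Γ.primFun_coord hg x
  · rw [Γ.topL_testParam_of_ne g h, primFun_zero_right]

theorem dispL_testParam {p : E × Field4} {g : IntervalL2 (Γ.length p.1)}
    (hg : primFun (Γ.midL p (Γ.testParam p g)) (Γ.length p.1) = 0) (e : E) (x : V) :
    Γ.dispL e x (Γ.testParam p g) = 0 := by
  simp [dispL, Γ.valL_testParam hg]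

theorem jointDispL_testParam {p : E × Field4} {g : IntervalL2 (Γ.length p.1)}
    (hg : primFun (Γ.midL p (Γ.testParam p g)) (Γ.length p.1) = 0) (x : V) :
    Γ.jointDispL x (Γ.testParam p g) = 0 := by
  rw [jointDispL]
  split_ifs with h
  · exact Γ.dispL_testParam hg _ x
  · rfl

section TestParam

variable {p : E × Field4} {g : IntervalL2 (Γ.length p.1)}
  (hg : primFun g (Γ.length p.1) = 0)
  (hg' : primFun (Γ.midL p (Γ.testParam p g)) (Γ.length p.1) = 0)
include hg hg'

theorem rotL_testParam (e : E) (x : V) : Γ.rotL e x (Γ.testParam p g) = 0 := by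
  simp [rotL, Γ.valL_testParam hg', Γ.slopeL_testParam hg]

theorem jointRotL_testParam (x : V) : Γ.jointRotL x (Γ.testParam p g) = 0 := by
  rw [jointRotL]
  split_ifs with h
  · exact Γ.rotL_testParam hg hg' _ x
  · rfl

theorem testParam_mem (P Q : Set V) : Γ.testParam p g ∈ Γ.formParam P Q := by
  refine ⟨fun q _ => rfl, fun x => ⟨fun e e' _ _ => ?_, fun e e' _ _ => ?_, fun _ => ?_, fun _ => ?_⟩⟩
  · rw [disp_embL, disp_embL, Γ.dispL_testParam hg', Γ.dispL_testParam hg']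
  · rw [rot_embL, rot_embL, Γ.rotL_testParam hg hg', Γ.rotL_testParam hg hg']
  · rw [jointDisp_embL, Γ.jointDispL_testParam hg']
  · rw [jointRot_embL, Γ.jointRotL_testParam hg hg']

end TestParam

/-- Initial values and a top derivative with prescribed values and slopes at the ends. -/
theorem exists_init_top (p : E × Field4) (A B A' B' : ℂ) :
    ∃ (c : Fin 2 → ℂ) (g : IntervalL2 (Γ.length p.1)), c 0 = A ∧
      (p.2.bending = true → c 1 = A' ∧ c 0 + primFun (prim (c 1) g) (Γ.length p.1) = B ∧
        c 1 + primFun g (Γ.length p.1) = B') ∧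
      (p.2.bending = false → c 1 = 0 ∧ c 0 + primFun g (Γ.length p.1) = B) := by
  rcases Bool.eq_false_or_eq_true p.2.bending with hp | hp
  -- For a bending field the slope must change by B' − A' and the value by B − A, starting from
  -- value A and slope A'.
  · obtain ⟨g, hg, hg'⟩ := exists_primFun_eq_primFun_prim_eq (Γ.length_pos p.1) A' (B' - A') (B - A)
    refine ⟨![A, A'], g, rfl, fun _ => ⟨rfl, ?_, ?_⟩, by simp [hp]⟩
    · exact (congrArg (A + ·) hg').trans (by ring)
    · exact (congrArg (A' + ·) hg).trans (by ring)
  · obtain ⟨g, hg⟩ := exists_primFun_eq (Γ.length_pos p.1) (B - A)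
    exact ⟨![A, 0], g, rfl, by simp [hp], fun _ => ⟨rfl, (congrArg (A + ·) hg).trans (by ring)⟩⟩

/-- There are parameters with prescribed values and slopes at all joints. -/
theorem exists_param_val_slope (t t' : V → E × Field4 → ℂ) :
    ∃ y : Γ.Param, (∀ p : E × Field4, p.2.bending = false → Γ.initL (p.1, p.2, 1) y = 0) ∧
      ∀ x (p : E × Field4), Γ.Incident p.1 x → Γ.valL p x y = t x p ∧
        (p.2.bending = true → Γ.slopeL p x y = t' x p) := by
  choose c g h0 hb hn using fun p : E × Field4 => Γ.exists_init_top p (t (Γ.origin p.1) p)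
    (t (Γ.terminus p.1) p) (t' (Γ.origin p.1) p) (t' (Γ.terminus p.1) p)
  refine ⟨Γ.mkParam (fun i => c (i.1, i.2.1) i.2.2) g, fun p hp => (hn p hp).1, fun x p hx => ?_⟩
  have hc0 : Γ.initL (p.1, p.2, 0) (Γ.mkParam (fun i => c (i.1, i.2.1) i.2.2) g) = c p 0 := rfl
  have hc1 : Γ.initL (p.1, p.2, 1) (Γ.mkParam (fun i => c (i.1, i.2.1) i.2.2) g) = c p 1 := rfl
  rw [valL_apply, slopeL_apply, hc0, hc1, topL_mkParam]
  rcases hx with rfl | rfl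
  · rw [coord_origin, primFun_zero, primFun_zero, add_zero, add_zero]
    exact ⟨h0 p, fun hp => (hb p hp).1⟩
  · rw [coord_terminus]
    refine ⟨?_, fun hp => (hb p hp).2.2⟩
    rcases Bool.eq_false_or_eq_true p.2.bending with hp | hp
    · rw [Γ.midL_of_bending _ hp, hc1, topL_mkParam]
      exact (hb p hp).2.1
    · rw [Γ.midL_of_not_bending _ hp, topL_mkParam]
      exact (hn p hp).2

/-- The displacements and rotations of the joints can be prescribed. -/
theorem exists_formParam_joint {P Q : Set V} (G W : V → EuclideanSpace ℂ (Fin 3))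
    (hP : ∀ x ∈ P, G x = 0) (hQ : ∀ x ∈ Q, W x = 0) :
    ∃ y ∈ Γ.formParam P Q, ∀ e x, Γ.Incident e x → Γ.dispL e x y = G x ∧ Γ.rotL e x y = W x := by
  choose X Y Z hvec using Γ.vec_surjective
  -- The joint vectors are resolved in each beam's basis. The slope of `v` is minus the second
  -- component of the rotation, matching η i − v' j + w' k.
  obtain ⟨y, hy, hy'⟩ := Γ.exists_param_val_slope
    (fun x p => match p.2 with
      | .v => Z p.1 (G x)
      | .w => Y p.1 (G x)
      | .u => X p.1 (G x)
      | .η => X p.1 (W x))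
    (fun x p => match p.2 with
      | .v => -Y p.1 (W x)
      | .w => Z p.1 (W x)
      | _ => 0)
  have hd : ∀ e x, Γ.Incident e x → Γ.dispL e x y = G x ∧ Γ.rotL e x y = W x := by
    intro e x hx
    have h1 := (hy' x (e, .u) hx).1
    have h2 := (hy' x (e, .w) hx).1
    have h3 := (hy' x (e, .v) hx).1
    have h4 := (hy' x (e, .η) hx).1
    have h5 := (hy' x (e, .v) hx).2 rfl
    have h6 := (hy' x (e, .w) hx).2 rfl
    rw [← disp_embL, ← rot_embL, disp_eq_vec, rot_eq_vec]
    simp only [val_embL_zero, Γ.val_embL_one y e (F := .v) rfl, Γ.val_embL_one y e (F := .w) rfl,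
      h1, h2, h3, h4, h5, h6, neg_neg]
    exact ⟨hvec _ _, hvec _ _⟩
  refine ⟨y, ⟨hy, fun x => ⟨fun e e' he he' => ?_, fun e e' he he' => ?_, fun hx => ?_,
    fun hx => ?_⟩⟩, hd⟩
  · rw [disp_embL, disp_embL, (hd e x he).1, (hd e' x he').1]
  · rw [rot_embL, rot_embL, (hd e x he).2, (hd e' x he').2]
  · rw [jointDisp_embL, jointDispL]
    split_ifs with h
    · rw [(hd _ x h.choose_spec).1, hP x hx]
    · rfl
  · rw [jointRot_embL, jointRotL]
    split_ifs with h
    · rw [(hd _ x h.choose_spec).2, hQ x hx]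
    · rfl

section Form

variable [Fintype V] [Fintype E] (P Q : Set V) (θ φ : V → ℝ)

/-- The operator of the energy form on the space of parameters. -/
noncomputable def paramOp : Γ.Param →L[ℂ] Γ.Param :=
  ∑ p, (Γ.stiffness p : ℂ) • (ContinuousLinearMap.adjoint (Γ.topL p)).comp (Γ.topL p) +
    ∑ x, ((θ x : ℂ) • (ContinuousLinearMap.adjoint (Γ.jointDispL x)).comp (Γ.jointDispL x) +
      (φ x : ℂ) • (ContinuousLinearMap.adjoint (Γ.jointRotL x)).comp (Γ.jointRotL x))

theorem inner_paramOp (z y : Γ.Param) : inner ℂ z (Γ.paramOp θ φ y) =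
    ∑ p, (Γ.stiffness p : ℂ) * inner ℂ (Γ.topL p z) (Γ.topL p y) +
      ∑ x, ((θ x : ℂ) * inner ℂ (Γ.jointDispL x z) (Γ.jointDispL x y) +
        (φ x : ℂ) * inner ℂ (Γ.jointRotL x z) (Γ.jointRotL x y)) := by
  simp only [paramOp, add_apply, sum_apply, smul_apply, ContinuousLinearMap.comp_apply, inner_add_right, inner_sum,
    inner_smul_right, ContinuousLinearMap.adjoint_inner_right]

/-- The operator of the energy form on the form domain. -/
noncomputable def formOp : Γ.FormSpace P Q →L[ℂ] Γ.FormSpace P Q :=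
  (ContinuousLinearMap.adjoint (Γ.incl P Q).toContinuousLinearMap).comp
    ((Γ.paramOp θ φ).comp (Γ.incl P Q).toContinuousLinearMap)

theorem inner_formOp (z y : Γ.FormSpace P Q) : inner ℂ z (Γ.formOp P Q θ φ y) =
    ∑ p, (Γ.stiffness p : ℂ) * inner ℂ (Γ.topL p (Γ.incl P Q z)) (Γ.topL p (Γ.incl P Q y)) +
      ∑ x, ((θ x : ℂ) * inner ℂ (Γ.jointDispL x (Γ.incl P Q z)) (Γ.jointDispL x (Γ.incl P Q y)) +
        (φ x : ℂ) * inner ℂ (Γ.jointRotL x (Γ.incl P Q z)) (Γ.jointRotL x (Γ.incl P Q y))) := by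
  rw [formOp, ContinuousLinearMap.comp_apply, ContinuousLinearMap.adjoint_inner_right,
    ← inner_paramOp]
  rfl

theorem formOp_symm (z y : Γ.FormSpace P Q) :
    inner ℂ (Γ.formOp P Q θ φ z) y = inner ℂ z (Γ.formOp P Q θ φ y) := by
  rw [← inner_conj_symm (𝕜 := ℂ) (Γ.formOp P Q θ φ z) y, inner_formOp, inner_formOp]
  simp only [map_add, map_sum, map_mul, Complex.conj_ofReal, inner_conj_symm]

theorem inner_formOp_self (y : Γ.FormSpace P Q) : inner ℂ y (Γ.formOp P Q θ φ y) =
    ((∑ p, Γ.stiffness p * ‖Γ.topL p (Γ.incl P Q y)‖ ^ 2 +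
      ∑ x, (θ x * ‖Γ.jointDispL x (Γ.incl P Q y)‖ ^ 2 + φ x * ‖Γ.jointRotL x (Γ.incl P Q y)‖ ^ 2) : ℝ) : ℂ) := by
  rw [inner_formOp]
  simp only [inner_self_eq_norm_sq_to_K]
  push_cast
  rfl

omit [Fintype V] in
theorem exists_stiffness_lower_bound : ∃ κ > 0, ∀ p, κ ≤ Γ.stiffness p := by
  rcases isEmpty_or_nonempty (E × Field4) with h | h
  · exact ⟨1, one_pos, fun p => h.elim p⟩
  · obtain ⟨p, hp⟩ := Finite.exists_min Γ.stiffness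
    exact ⟨Γ.stiffness p, Γ.stiffness_pos p, hp⟩

/-- The energy form is coercive relative to the norm of the states. -/
theorem exists_coercive : ∃ κ > 0, ∃ K : ℝ, ∀ y : Γ.FormSpace P Q,
    κ * ‖y‖ ^ 2 ≤ (inner ℂ y (Γ.formOp P Q θ φ y)).re + K * ‖Γ.formEmb P Q y‖ ^ 2 := by
  obtain ⟨κ, hκ, hmin⟩ := Γ.exists_stiffness_lower_bound
  have hinj := Γ.formEmb_injective P Q
  let sub := (Γ.incl P Q).toContinuousLinearMap
  -- These are exactly the terms that keep the beam energy from dominating κ‖y‖²: the initial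
  -- values, and the joint terms in absolute value.
  have hsmall : RelSmall (Γ.formEmb P Q) fun y : Γ.FormSpace P Q =>
      κ * ∑ i, ‖Γ.initL i (Γ.incl P Q y)‖ ^ 2 +
        ∑ x, (|θ x| * ‖Γ.jointDispL x (Γ.incl P Q y)‖ ^ 2 + |φ x| * ‖Γ.jointRotL x (Γ.incl P Q y)‖ ^ 2) :=
    ((RelSmall.sum _ fun i _ => RelSmall.norm_sq_functional hinj ((Γ.initL i).comp sub)).const_mul
      hκ.le).add (RelSmall.sum _ fun x _ =>
        ((RelSmall.norm_sq_euclidean hinj ((Γ.jointDispL x).comp sub)).const_mul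
          (abs_nonneg _)).add
        ((RelSmall.norm_sq_euclidean hinj ((Γ.jointRotL x).comp sub)).const_mul (abs_nonneg _)))
  -- Half of κ‖y‖² absorbs the small terms and the other half survives as the coercivity constant.
  obtain ⟨K, hK⟩ := hsmall (κ / 2) (by positivity)
  refine ⟨κ / 2, by positivity, K, fun y => ?_⟩
  have h1 := hK y
  have h2 : ‖y‖ ^ 2 = ∑ i, ‖Γ.initL i (Γ.incl P Q y)‖ ^ 2 + ∑ p, ‖Γ.topL p (Γ.incl P Q y)‖ ^ 2 := by
    rw [← (Γ.incl P Q).norm_map]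
    exact Γ.norm_sq_param _
  have h3 : κ * ∑ p, ‖Γ.topL p (Γ.incl P Q y)‖ ^ 2 ≤ ∑ p, Γ.stiffness p * ‖Γ.topL p (Γ.incl P Q y)‖ ^ 2 := by
    rw [Finset.mul_sum]
    exact Finset.sum_le_sum fun p _ => mul_le_mul_of_nonneg_right (hmin p) (sq_nonneg _)
  have h4 : -∑ x, (|θ x| * ‖Γ.jointDispL x (Γ.incl P Q y)‖ ^ 2 + |φ x| * ‖Γ.jointRotL x (Γ.incl P Q y)‖ ^ 2) ≤
      ∑ x, (θ x * ‖Γ.jointDispL x (Γ.incl P Q y)‖ ^ 2 + φ x * ‖Γ.jointRotL x (Γ.incl P Q y)‖ ^ 2) := by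
    rw [← Finset.sum_neg_distrib]
    refine Finset.sum_le_sum fun x _ => ?_
    nlinarith [mul_le_mul_of_nonneg_right (neg_abs_le (θ x)) (sq_nonneg ‖Γ.jointDispL x (Γ.incl P Q y)‖),
      mul_le_mul_of_nonneg_right (neg_abs_le (φ x)) (sq_nonneg ‖Γ.jointRotL x (Γ.incl P Q y)‖)]
  rw [inner_formOp_self, Complex.ofReal_re]
  have h5 := congrArg (κ * ·) h2
  simp only [mul_add] at h5
  linarith

variable {P Q θ φ}

/-- A test parameter is invisible to all joint terms and lives on one field of one beam, so the form
reduces to a single interval pairing. -/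
theorem inner_formOp_testParam {p : E × Field4} {g : IntervalL2 (Γ.length p.1)}
    (hg : primFun g (Γ.length p.1) = 0)
    (hg' : primFun (Γ.midL p (Γ.testParam p g)) (Γ.length p.1) = 0) {z : Γ.FormSpace P Q}
    (hz : Γ.incl P Q z = Γ.testParam p g) (y : Γ.FormSpace P Q) :
    inner ℂ z (Γ.formOp P Q θ φ y) =
      Γ.stiffness p * inner ℂ g (Γ.topL p (Γ.incl P Q y)) := by
  rw [inner_formOp, hz, Finset.sum_eq_single p (fun q _ hq => by
    rw [Γ.topL_testParam_of_ne g hq, inner_zero_left, mul_zero]) (by simp), topL_testParam_self]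
  simp only [Γ.jointDispL_testParam hg', Γ.jointRotL_testParam hg hg', inner_zero_left, mul_zero,
    add_zero, Finset.sum_const_zero]

omit [Fintype V] in
theorem inner_formEmb_testParam (p : E × Field4) (g : IntervalL2 (Γ.length p.1)) (f : Γ.State) :
    inner ℂ (Γ.embL (Γ.testParam p g)) f = inner ℂ (prim 0 (Γ.midL p (Γ.testParam p g))) (f p) := by
  rw [PiLp.inner_apply, Finset.sum_eq_single p (fun q _ hq => by
    rw [Γ.embL_testParam_of_ne g hq, inner_zero_left]) (by simp)]
  rfl

section Regularity

variable {y : Γ.FormSpace P Q} {f : Γ.State}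
  (h : ∀ z, inner ℂ z (Γ.formOp P Q θ φ y) = inner ℂ (Γ.formEmb P Q z) f)
include h

/-- Testing with fields clamped at both ends isolates the weak equation k G'' = f on one beam, where
k is the stiffness and G the top derivative. -/
theorem exists_topL_eq_of_bending {p : E × Field4} (hp : p.2.bending = true) :
    ∃ d₀ d₁, (Γ.stiffness p : ℂ) • Γ.topL p (Γ.incl P Q y) = prim d₀ (prim d₁ (f p)) := by
  refine exists_eq_prim_prim_of_inner_eq fun g hg hg' => ?_
  have hm : Γ.midL p (Γ.testParam p g) = prim 0 g := by
    rw [Γ.midL_of_bending _ hp, initL_testParam, topL_testParam_self]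
  rw [← hm] at hg' ⊢
  obtain ⟨z, hz⟩ := Γ.exists_incl_eq (Γ.testParam_mem hg hg' P Q)
  rw [inner_smul_right, ← Γ.inner_formOp_testParam (θ := θ) (φ := φ) hg hg' hz y, h,
    formEmb_apply, hz, inner_formEmb_testParam]

theorem exists_topL_eq_of_not_bending {p : E × Field4} (hp : p.2.bending = false) :
    ∃ d, (Γ.stiffness p : ℂ) • Γ.topL p (Γ.incl P Q y) = prim d (-f p) := by
  refine exists_eq_prim_of_inner_eq fun g hg => ?_
  have hm : Γ.midL p (Γ.testParam p g) = g := by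
    rw [Γ.midL_of_not_bending _ hp, topL_testParam_self]
  have hg' : primFun (Γ.midL p (Γ.testParam p g)) (Γ.length p.1) = 0 := by rwa [hm]
  obtain ⟨z, hz⟩ := Γ.exists_incl_eq (Γ.testParam_mem hg hg' P Q)
  rw [inner_smul_right, ← Γ.inner_formOp_testParam (θ := θ) (φ := φ) hg hg' hz y, h,
    formEmb_apply, hz, inner_formEmb_testParam, hm]

/-- The top derivative is a double primitive of f divided by the stiffness, so the field is a
fourfold primitive: its H⁴ regularity and fourth derivative can be read off. -/
theorem regularity_of_bending {p : E × Field4} (hp : p.2.bending = true) :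
    MemSobolev 4 (Γ.embL (Γ.incl P Q y) p) ∧ f p = Γ.stiffness p • weakDerivN 4 (Γ.embL (Γ.incl P Q y) p) := by
  obtain ⟨d₀, d₁, hd⟩ := Γ.exists_topL_eq_of_bending h hp
  have hℓ := Γ.length_pos p.1
  have hs : (Γ.stiffness p : ℂ) ≠ 0 := Complex.ofReal_ne_zero.2 (Γ.stiffness_pos p).ne'
  rw [← eq_inv_smul_iff₀ hs, smul_prim, smul_prim] at hd
  rw [Γ.embL_bending _ hp, hd]
  refine ⟨?_, ?_⟩
  · iterate 4 rw [memSobolev_prim_iff hℓ]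
    trivial
  · iterate 4 rw [weakDerivN_prim hℓ]
    rw [weakDerivN_zero, IntervalL2.real_smul, smul_inv_smul₀ hs]

theorem regularity_of_not_bending {p : E × Field4} (hp : p.2.bending = false) :
    MemSobolev 2 (Γ.embL (Γ.incl P Q y) p) ∧ f p = -(Γ.stiffness p • weakDerivN 2 (Γ.embL (Γ.incl P Q y) p)) := by
  obtain ⟨d, hd⟩ := Γ.exists_topL_eq_of_not_bending h hp
  have hℓ := Γ.length_pos p.1
  have hs : (Γ.stiffness p : ℂ) ≠ 0 := Complex.ofReal_ne_zero.2 (Γ.stiffness_pos p).ne'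
  rw [← eq_inv_smul_iff₀ hs, smul_prim] at hd
  rw [Γ.embL_not_bending _ hp, hd]
  refine ⟨?_, ?_⟩
  · iterate 2 rw [memSobolev_prim_iff hℓ]
    trivial
  · iterate 2 rw [weakDerivN_prim hℓ]
    rw [weakDerivN_zero, IntervalL2.real_smul, smul_inv_smul₀ hs, neg_neg]

theorem memOpSobolev_of_inner_eq : Γ.MemOpSobolev (Γ.embL (Γ.incl P Q y)) := fun e =>
  ⟨(Γ.regularity_of_bending h (p := (e, .v)) rfl).1,
    (Γ.regularity_of_bending h (p := (e, .w)) rfl).1,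
    (Γ.regularity_of_not_bending h (p := (e, .u)) rfl).1,
    (Γ.regularity_of_not_bending h (p := (e, .η)) rfl).1⟩

theorem isDiffExpr_of_inner_eq : Γ.IsDiffExpr (Γ.embL (Γ.incl P Q y)) f := fun e =>
  ⟨(Γ.regularity_of_bending h (p := (e, .v)) rfl).2,
    (Γ.regularity_of_bending h (p := (e, .w)) rfl).2,
    (Γ.regularity_of_not_bending h (p := (e, .u)) rfl).2,
    (Γ.regularity_of_not_bending h (p := (e, .η)) rfl).2⟩

end Regularity

variable (P Q) in
theorem denseRange_formEmb : DenseRange (Γ.formEmb P Q) := by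
  have h : Dense (LinearMap.range (Γ.formEmb P Q).toLinearMap : Set Γ.State) := by
    rw [Submodule.dense_iff_topologicalClosure_eq_top, Submodule.topologicalClosure_eq_top_iff,
      Submodule.eq_bot_iff]
    intro f hf
    -- If f is orthogonal to the form domain, then y = 0 solves the weak equation with right-hand
    -- side f. The regularity argument writes 0 as an iterated primitive of f, up to sign, and
    -- uniqueness forces f = 0.
    have h0 : ∀ z, inner ℂ z (Γ.formOp P Q 0 0 0) = inner ℂ (Γ.formEmb P Q z) f := fun z => by
      rw [map_zero, inner_zero_right]
      exact (hf _ ⟨z, rfl⟩).symm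
    ext1 p
    have hℓ := Γ.length_pos p.1
    rcases Bool.eq_false_or_eq_true p.2.bending with hp | hp
    · obtain ⟨d₀, d₁, hd⟩ := Γ.exists_topL_eq_of_bending h0 hp
      rw [map_zero, map_zero, smul_zero] at hd
      have h1 := prim_injective hℓ (prim_zero_zero.trans hd)
      exact (prim_injective hℓ (prim_zero_zero.trans h1.2)).2.symm
    · obtain ⟨d, hd⟩ := Γ.exists_topL_eq_of_not_bending h0 hp
      rw [map_zero, map_zero, smul_zero] at hd
      exact neg_eq_zero.1 (prim_injective hℓ (prim_zero_zero.trans hd)).2.symm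
  exact h

omit [Fintype V] in
theorem memFormSobolev_embL (y : Γ.FormSpace P Q) : Γ.MemFormSobolev (Γ.embL (Γ.incl P Q y)) :=
  ((Γ.exists_formEmb_eq_iff P Q _).1 ⟨y, rfl⟩).1

/-- The defect of the form equation is supported at the joints. -/
theorem inner_formOp_sub (z y : Γ.FormSpace P Q) {f : Γ.State}
    (hy : Γ.MemOpSobolev (Γ.embL (Γ.incl P Q y))) (hf : Γ.IsDiffExpr (Γ.embL (Γ.incl P Q y)) f) :
    inner ℂ z (Γ.formOp P Q θ φ y) - inner ℂ (Γ.formEmb P Q z) f =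
      ∑ x, (inner ℂ (Γ.jointDispL x (Γ.incl P Q z))
          (θ x • Γ.jointDisp (Γ.embL (Γ.incl P Q y)) x - Γ.force (Γ.embL (Γ.incl P Q y)) x) +
        inner ℂ (Γ.jointRotL x (Γ.incl P Q z))
          (φ x • Γ.jointRot (Γ.embL (Γ.incl P Q y)) x - Γ.moment (Γ.embL (Γ.incl P Q y)) x)) := by
  have h := Γ.green (Γ.memFormSobolev_embL z) (fun x => ((Γ.incl_mem z).2 x).1)
    (fun x => ((Γ.incl_mem z).2 x).2.1) hy hf
  simp only [topDeriv_embL, jointDisp_embL, jointRot_embL] at h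
  rw [inner_formOp, h, formEmb_apply]
  simp only [jointDisp_embL, jointRot_embL, inner_sub_right, ← Complex.coe_smul, inner_smul_right,
    Finset.sum_add_distrib,
    Finset.sum_sub_distrib]
  ring

end Form

end BeamFrame

/-! ### Natural joint conditions and the Hamiltonian -/

namespace BeamFrame

variable {V E : Type*} (Γ : BeamFrame V E)

theorem jointDisp_eq_zero_of_isolated {x : V} (hx : ¬ ∃ e, Γ.Incident e x) (Ψ : Γ.State) :
    Γ.jointDisp Ψ x = 0 := by
  rw [jointDisp, dif_neg hx]

theorem jointRot_eq_zero_of_isolated {x : V} (hx : ¬ ∃ e, Γ.Incident e x) (Ψ : Γ.State) :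
    Γ.jointRot Ψ x = 0 := by
  rw [jointRot, dif_neg hx]

theorem force_eq_zero_of_isolated [Fintype E] {x : V} (hx : ¬ ∃ e, Γ.Incident e x) (Ψ : Γ.State) :
    Γ.force Ψ x = 0 := by
  rw [force_eq]
  exact Finset.sum_eq_zero fun e _ => by rw [Γ.sign_eq_zero fun h => hx ⟨e, h⟩, zero_smul]

theorem moment_eq_zero_of_isolated [Fintype E] {x : V} (hx : ¬ ∃ e, Γ.Incident e x) (Ψ : Γ.State) :
    Γ.moment Ψ x = 0 := by
  rw [moment_eq]
  exact Finset.sum_eq_zero fun e _ => by rw [Γ.sign_eq_zero fun h => hx ⟨e, h⟩, zero_smul]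

theorem MemOpSobolev.memFormSobolev {Γ : BeamFrame V E} {Ψ : Γ.State}
    (h : Γ.MemOpSobolev Ψ) :
    Γ.MemFormSobolev Ψ := fun e =>
  ⟨(h e).1.of_le (Γ.length_pos e) (by norm_num), (h e).2.1.of_le (Γ.length_pos e) (by norm_num),
    (h e).2.2.1.of_le (Γ.length_pos e) (by norm_num),
    (h e).2.2.2.of_le (Γ.length_pos e) (by norm_num)⟩

theorem exists_isDiffExpr (Ψ : Γ.State) : ∃ f, Γ.IsDiffExpr Ψ f :=
  ⟨WithLp.toLp 2 fun p => match p with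
    | (e, .v) => Γ.a e • weakDerivN 4 (Ψ (e, .v))
    | (e, .w) => Γ.b e • weakDerivN 4 (Ψ (e, .w))
    | (e, .u) => -(Γ.c e • weakDerivN 2 (Ψ (e, .u)))
    | (e, .η) => -(Γ.d e • weakDerivN 2 (Ψ (e, .η))), fun _ => ⟨rfl, rfl, rfl, rfl⟩⟩

/-- The natural boundary conditions at the joint `x`. -/
def NaturalAt [Fintype E] (P Q : Set V) (θ φ : V → ℝ) (Ψ : Γ.State) (x : V) : Prop :=
  (x ∉ P → θ x • Γ.jointDisp Ψ x - Γ.force Ψ x = 0) ∧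
    (x ∉ Q → φ x • Γ.jointRot Ψ x - Γ.moment Ψ x = 0)

variable [Fintype E] {Γ} {P Q : Set V} {θ φ : V → ℝ}

theorem HasHamiltonian.congr {D D' : Γ.State → Prop} {U U' : Γ.State → ℝ} {bc bc' : Γ.State → Prop}
    (h : Γ.HasHamiltonian D U bc) (hD : ∀ Ψ, D Ψ ↔ D' Ψ) (hU : ∀ Ψ, U Ψ = U' Ψ)
    (hbc : ∀ Ψ, bc Ψ ↔ bc' Ψ) : Γ.HasHamiltonian D' U' bc' := by
  obtain rfl : D = D' := funext fun Ψ => propext (hD Ψ)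
  obtain rfl : U = U' := funext hU
  obtain rfl : bc = bc' := funext fun Ψ => propext (hbc Ψ)
  exact h

variable [Fintype V]

/-- After regularity, the weak equation says that the joint defects pair to zero with all admissible
joint data. The defects themselves, set to zero at constrained joints, are admissible data, so their
squared norms sum to zero. -/
theorem naturalAt_of_inner_eq {y : Γ.FormSpace P Q} {f : Γ.State}
    (h : ∀ z, inner ℂ z (Γ.formOp P Q θ φ y) = inner ℂ (Γ.formEmb P Q z) f) (x : V) :
    Γ.NaturalAt P Q θ φ (Γ.embL (Γ.incl P Q y)) x := by
  classical
  set Ψ := Γ.embL (Γ.incl P Q y)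
  set G : V → EuclideanSpace ℂ (Fin 3) := fun x =>
    if x ∈ P then 0 else θ x • Γ.jointDisp Ψ x - Γ.force Ψ x
  set W : V → EuclideanSpace ℂ (Fin 3) := fun x =>
    if x ∈ Q then 0 else φ x • Γ.jointRot Ψ x - Γ.moment Ψ x
  obtain ⟨z', hz', hz⟩ := Γ.exists_formParam_joint (P := P) (Q := Q) G W
    (fun x hx => if_pos hx) (fun x hx => if_pos hx)
  obtain ⟨z, rfl⟩ := Γ.exists_incl_eq hz'
  have hG : ∀ x, Γ.jointDispL x (Γ.incl P Q z) = G x := by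
    intro x
    rw [jointDispL]
    split_ifs with hx
    · exact (hz _ x hx.choose_spec).1
    -- At a joint without beams nothing can be prescribed, but the defect vanishes there as well.
    · simp [G, Γ.jointDisp_eq_zero_of_isolated hx, Γ.force_eq_zero_of_isolated hx]
  have hW : ∀ x, Γ.jointRotL x (Γ.incl P Q z) = W x := by
    intro x
    rw [jointRotL]
    split_ifs with hx
    · exact (hz _ x hx.choose_spec).2
    · simp [W, Γ.jointRot_eq_zero_of_isolated hx, Γ.moment_eq_zero_of_isolated hx]
  have key := Γ.inner_formOp_sub (θ := θ) (φ := φ) z y (Γ.memOpSobolev_of_inner_eq h)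
    (Γ.isDiffExpr_of_inner_eq h)
  rw [h z, sub_self] at key
  have hterm : ∀ x, inner ℂ (Γ.jointDispL x (Γ.incl P Q z))
      (θ x • Γ.jointDisp Ψ x - Γ.force Ψ x) + inner ℂ (Γ.jointRotL x (Γ.incl P Q z))
      (φ x • Γ.jointRot Ψ x - Γ.moment Ψ x) = ((‖G x‖ ^ 2 + ‖W x‖ ^ 2 : ℝ) : ℂ) := by
    intro x
    have h1 : inner ℂ (G x) (θ x • Γ.jointDisp Ψ x - Γ.force Ψ x) = inner ℂ (G x) (G x) := by
      by_cases hx : x ∈ P <;> simp [G, hx]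
    have h2 : inner ℂ (W x) (φ x • Γ.jointRot Ψ x - Γ.moment Ψ x) = inner ℂ (W x) (W x) := by
      by_cases hx : x ∈ Q <;> simp [W, hx]
    rw [hG, hW, h1, h2, inner_self_eq_norm_sq_to_K, inner_self_eq_norm_sq_to_K]
    push_cast
    rfl
  rw [Finset.sum_congr rfl fun x _ => hterm x, ← Complex.ofReal_sum, eq_comm,
    Complex.ofReal_eq_zero, Finset.sum_eq_zero_iff_of_nonneg fun x _ => by positivity] at key
  have hx := key x (Finset.mem_univ x)
  rw [add_eq_zero_iff_of_nonneg (by positivity) (by positivity), sq_eq_zero_iff, sq_eq_zero_iff,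
    norm_eq_zero, norm_eq_zero] at hx
  exact ⟨fun hP => by simpa only [G, if_neg hP] using hx.1,
    fun hQ => by simpa only [W, if_neg hQ] using hx.2⟩

/-- In each joint term of Green's identity one factor vanishes: the test datum at a constrained
joint, the defect at any other joint. -/
theorem inner_eq_of_naturalAt {y : Γ.FormSpace P Q} {f : Γ.State}
    (hS : Γ.MemOpSobolev (Γ.embL (Γ.incl P Q y))) (hf : Γ.IsDiffExpr (Γ.embL (Γ.incl P Q y)) f)
    (hN : ∀ x, Γ.NaturalAt P Q θ φ (Γ.embL (Γ.incl P Q y)) x) (z : Γ.FormSpace P Q) :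
    inner ℂ z (Γ.formOp P Q θ φ y) = inner ℂ (Γ.formEmb P Q z) f := by
  rw [← sub_eq_zero, Γ.inner_formOp_sub z y hS hf]
  refine Finset.sum_eq_zero fun x _ => ?_
  obtain ⟨-, -, hP, hQ⟩ := (Γ.incl_mem z).2 x
  rw [jointDisp_embL] at hP
  rw [jointRot_embL] at hQ
  have h1 : inner ℂ (Γ.jointDispL x (Γ.incl P Q z)) (θ x • Γ.jointDisp (Γ.embL (Γ.incl P Q y)) x -
      Γ.force (Γ.embL (Γ.incl P Q y)) x) = 0 := by
    by_cases hx : x ∈ P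
    · rw [hP hx, inner_zero_left]
    · rw [(hN x).1 hx, inner_zero_right]
  have h2 : inner ℂ (Γ.jointRotL x (Γ.incl P Q z)) (φ x • Γ.jointRot (Γ.embL (Γ.incl P Q y)) x -
      Γ.moment (Γ.embL (Γ.incl P Q y)) x) = 0 := by
    by_cases hx : x ∈ Q
    · rw [hQ hx, inner_zero_left]
    · rw [(hN x).2 hx, inner_zero_right]
  rw [h1, h2, add_zero]

variable (Γ P Q θ φ) in
/-- The Hamiltonian of a beam frame whose joints have the energies `θ |g| ^ 2 + φ |ω| ^ 2`, with
fixed displacements at the joints of `P` and fixed rotations at the joints of `Q`. -/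
theorem hasHamiltonian : Γ.HasHamiltonian
    (fun Ψ => Γ.MemFormSobolev Ψ ∧ ∀ x, Γ.RigidAt P Q Ψ x)
    (fun Ψ => ∑ e, Γ.beamEnergy Ψ e +
      ∑ x, (θ x * ‖Γ.jointDisp Ψ x‖ ^ 2 + φ x * ‖Γ.jointRot Ψ x‖ ^ 2))
    (fun Ψ => ∀ x, Γ.RigidAt P Q Ψ x ∧ Γ.NaturalAt P Q θ φ Ψ x) := by
  obtain ⟨κ, hκ, K, hK⟩ := Γ.exists_coercive P Q θ φ
  have hj := Γ.formEmb_injective P Q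
  have hd := Γ.denseRange_formEmb P Q
  have hS := Γ.formOp_symm P Q θ φ
  obtain ⟨H, hH, hsa⟩ := embeddedForm.exists_isAssociated hj hd hS hκ hK
  have hassoc : ∀ y f, (Γ.formEmb P Q y, f) ∈ H.graph ↔
      ∀ z, inner ℂ z (Γ.formOp P Q θ φ y) = inner ℂ (Γ.formEmb P Q z) f := by
    intro y f
    rw [hH]
    constructor
    · rintro ⟨hx, h⟩ z
      rw [← embeddedForm.form_mk (hj := hj)]
      exact h (embeddedForm.mk hj _ z)
    · intro h
      refine ⟨⟨y, rfl⟩, fun z => ?_⟩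
      obtain ⟨z, rfl⟩ := embeddedForm.mk_surjective z
      exact (embeddedForm.form_mk z y).trans (h z)
  have hdom : ∀ Ψ : H.domain, ∃ y, Γ.formEmb P Q y = Ψ ∧
      ∀ z, inner ℂ z (Γ.formOp P Q θ φ y) = inner ℂ (Γ.formEmb P Q z) (H Ψ) := by
    intro Ψ
    have hg : ((Ψ : Γ.State), H Ψ) ∈ H.graph := H.mem_graph Ψ
    obtain ⟨⟨y, hy⟩, -⟩ := (hH _ _).1 hg
    have hy' : Γ.formEmb P Q y = Ψ := hy
    rw [← hy'] at hg
    exact ⟨y, hy', (hassoc _ _).1 hg⟩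
  refine ⟨embeddedForm (Γ.formEmb P Q) hj (Γ.formOp P Q θ φ), H, Γ.exists_formEmb_eq_iff P Q, ?_,
    hd, embeddedForm.isHermitian hS, embeddedForm.isSemibounded hκ hK, embeddedForm.isClosed hκ hK,
    hH, hsa, ?_, ?_⟩
  · intro Ψ
    obtain ⟨y, rfl⟩ := embeddedForm.mk_surjective Ψ
    rw [embeddedForm.form_mk, inner_formOp_self, embeddedForm.coe_mk, formEmb_apply]
    simp only [← sum_stiffness_mul_norm_sq, topDeriv_embL, jointDisp_embL, jointRot_embL]
  · intro Ψ
    constructor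
    · intro hΨ
      obtain ⟨y, hy, h⟩ := hdom ⟨Ψ, hΨ⟩
      obtain rfl : Γ.embL (Γ.incl P Q y) = Ψ := hy
      exact ⟨Γ.memOpSobolev_of_inner_eq h, fun x =>
        ⟨(Γ.incl_mem y).2 x, naturalAt_of_inner_eq h x⟩⟩
    -- Conversely, the differential expression applied to Ψ is the candidate for H Ψ, and the
    -- natural conditions turn Green's identity into the weak equation.
    · rintro ⟨hS, hbc⟩
      obtain ⟨y, hy⟩ := (Γ.exists_formEmb_eq_iff P Q Ψ).2 ⟨hS.memFormSobolev, fun x => (hbc x).1⟩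
      obtain ⟨f, hf⟩ := Γ.exists_isDiffExpr Ψ
      have hg : (Ψ, f) ∈ H.graph := by
        obtain rfl : Γ.embL (Γ.incl P Q y) = Ψ := hy
        exact (hassoc _ _).2 (inner_eq_of_naturalAt hS hf fun x => (hbc x).2)
      exact LinearPMap.mem_domain_of_mem_graph hg
  · intro Ψ
    obtain ⟨y, hy, h⟩ := hdom Ψ
    have := Γ.isDiffExpr_of_inner_eq h
    rwa [← formEmb_apply, hy] at this

end BeamFrame

/-! ### Trigonometric form of the joint conditions, and the theorem -/

theorem tan_div_two_smul_sub_eq_zero_iff {X : Type*} [AddCommGroup X] [Module ℝ X] {t : ℝ}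
    (ht : t ∈ Ioo (-(Real.pi / 2)) (Real.pi / 2)) (g F : X) :
    (Real.tan t / 2) • g - F = 0 ↔ Real.sin t • g - (2 * Real.cos t) • F = 0 := by
  have hc := (Real.cos_pos_of_mem_Ioo ht).ne'
  have h : Real.sin t • g - (2 * Real.cos t) • F =
      (2 * Real.cos t) • ((Real.tan t / 2) • g - F) := by
    rw [smul_sub, smul_smul, Real.tan_eq_sin_div_cos]
    congr 2
    field_simp
  rw [h, smul_eq_zero_iff_right (mul_ne_zero two_ne_zero hc)]

/-- For t ≠ π/2 the two equations differ by the nonzero factor −cos t. At t = π/2 the cosine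
vanishes and only the constraint g = 0 is left. -/
theorem robin_iff {X : Type*} [AddCommGroup X] [Module ℝ X] {t : ℝ}
    (ht : t ∈ Ioc (-(Real.pi / 2)) (Real.pi / 2)) (g F : X) :
    (t = Real.pi / 2 → g = 0) ∧ (t ≠ Real.pi / 2 → (-Real.tan t) • g - F = 0) ↔
      Real.sin t • g + Real.cos t • F = 0 := by
  by_cases h : t = Real.pi / 2
  · simp [h]
  · have hc := (Real.cos_pos_of_mem_Ioo ⟨ht.1, lt_of_le_of_ne ht.2 h⟩).ne'
    have h1 : Real.sin t • g + Real.cos t • F = (-Real.cos t) • ((-Real.tan t) • g - F) := by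
      rw [smul_sub, smul_smul, Real.tan_eq_sin_div_cos, neg_mul_neg, mul_div_cancel₀ _ hc, neg_smul,
        sub_neg_eq_add]
    rw [h1, smul_eq_zero_iff_right (neg_ne_zero.2 hc)]
    simp [h]

theorem theorem4p4 {V E : Type*} [Fintype V] [Fintype E] (Γ : BeamFrame V E) (α β : V → ℝ) :
    -- the Hamiltonian of the energy with vertex energy `½ (|g|² tan α + |ω|² tan β)`
    ((∀ x, α x ∈ Ioo (-(Real.pi / 2)) (Real.pi / 2)) →
      (∀ x, β x ∈ Ioo (-(Real.pi / 2)) (Real.pi / 2)) →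
      Γ.HasHamiltonian
        (fun Ψ => Γ.MemFormSobolev Ψ ∧ ∀ x, Γ.DispContinuousAt Ψ x ∧ Γ.RotContinuousAt Ψ x)
        (fun Ψ => ∑ e, Γ.beamEnergy Ψ e + ∑ x, Γ.vertexEnergy α β Ψ x)
        (fun Ψ => ∀ x, Γ.DispContinuousAt Ψ x ∧ Γ.RotContinuousAt Ψ x ∧
          Real.sin (α x) • Γ.jointDisp Ψ x - (2 * Real.cos (α x)) • Γ.force Ψ x = 0 ∧
          Real.sin (β x) • Γ.jointRot Ψ x - (2 * Real.cos (β x)) • Γ.moment Ψ x = 0)) ∧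
    -- the Robin-type conditions `g sin α + cos α F = 0`, `ω sin β + cos β M = 0`,
    -- including the value `π / 2`, for which the form domain is constrained
    ((∀ x, α x ∈ Ioc (-(Real.pi / 2)) (Real.pi / 2)) →
      (∀ x, β x ∈ Ioc (-(Real.pi / 2)) (Real.pi / 2)) →
      Γ.HasHamiltonian
        (fun Ψ => Γ.MemFormSobolev Ψ ∧ ∀ x, Γ.DispContinuousAt Ψ x ∧ Γ.RotContinuousAt Ψ x ∧
          (α x = Real.pi / 2 → Γ.jointDisp Ψ x = 0) ∧
          (β x = Real.pi / 2 → Γ.jointRot Ψ x = 0))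
        (fun Ψ => ∑ e, Γ.beamEnergy Ψ e - 2 * ∑ x, Γ.vertexEnergy α β Ψ x)
        (fun Ψ => ∀ x, Γ.VertexConditions α β Ψ x)) ∧
    -- free, clamped, pinned and guided joints
    (∀ (Ψ : Γ.State) (x : V),
      (α x = 0 → β x = 0 → (Γ.VertexConditions α β Ψ x ↔
        Γ.DispContinuousAt Ψ x ∧ Γ.RotContinuousAt Ψ x ∧
          Γ.force Ψ x = 0 ∧ Γ.moment Ψ x = 0)) ∧
      (α x = Real.pi / 2 → β x = Real.pi / 2 → (Γ.VertexConditions α β Ψ x ↔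
        (∀ e, Γ.Incident e x → Γ.disp Ψ e x = 0) ∧ ∀ e, Γ.Incident e x → Γ.rot Ψ e x = 0)) ∧
      (α x = Real.pi / 2 → β x = 0 → (Γ.VertexConditions α β Ψ x ↔
        (∀ e, Γ.Incident e x → Γ.disp Ψ e x = 0) ∧
          Γ.RotContinuousAt Ψ x ∧ Γ.moment Ψ x = 0)) ∧
      (α x = 0 → β x = Real.pi / 2 → (Γ.VertexConditions α β Ψ x ↔
        (∀ e, Γ.Incident e x → Γ.rot Ψ e x = 0) ∧
          Γ.DispContinuousAt Ψ x ∧ Γ.force Ψ x = 0))) ∧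
    -- the same conditions, written in components, at a joint of degree one
    (∀ (Ψ : Γ.State) (x : V) (e : E), (∀ e', Γ.Incident e' x ↔ e' = e) →
      (α x = 0 → β x = 0 → (Γ.VertexConditions α β Ψ x ↔
        (Γ.val Ψ e .u 1 x = 0 ∧ Γ.val Ψ e .w 3 x = 0 ∧ Γ.val Ψ e .v 3 x = 0) ∧
        (Γ.val Ψ e .η 1 x = 0 ∧ Γ.val Ψ e .v 2 x = 0 ∧ Γ.val Ψ e .w 2 x = 0))) ∧
      (α x = Real.pi / 2 → β x = Real.pi / 2 → (Γ.VertexConditions α β Ψ x ↔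
        (Γ.val Ψ e .u 0 x = 0 ∧ Γ.val Ψ e .w 0 x = 0 ∧ Γ.val Ψ e .v 0 x = 0) ∧
        (Γ.val Ψ e .η 0 x = 0 ∧ Γ.val Ψ e .v 1 x = 0 ∧ Γ.val Ψ e .w 1 x = 0))) ∧
      (α x = Real.pi / 2 → β x = 0 → (Γ.VertexConditions α β Ψ x ↔
        (Γ.val Ψ e .u 0 x = 0 ∧ Γ.val Ψ e .w 0 x = 0 ∧ Γ.val Ψ e .v 0 x = 0) ∧
        (Γ.val Ψ e .η 1 x = 0 ∧ Γ.val Ψ e .v 2 x = 0 ∧ Γ.val Ψ e .w 2 x = 0))) ∧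
      (α x = 0 → β x = Real.pi / 2 → (Γ.VertexConditions α β Ψ x ↔
        (Γ.val Ψ e .η 0 x = 0 ∧ Γ.val Ψ e .v 1 x = 0 ∧ Γ.val Ψ e .w 1 x = 0) ∧
        (Γ.val Ψ e .u 1 x = 0 ∧ Γ.val Ψ e .w 3 x = 0 ∧ Γ.val Ψ e .v 3 x = 0)))) := by
  refine ⟨fun hα hβ => ?_, fun hα hβ => ?_, fun Ψ x => ?_, fun Ψ x e hx => ?_⟩
  · refine (Γ.hasHamiltonian ∅ ∅ (fun x => Real.tan (α x) / 2)
      (fun x => Real.tan (β x) / 2)).congr (fun Ψ => ?_) (fun Ψ => ?_) (fun Ψ => ?_)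
    · simp [BeamFrame.RigidAt]
    · congr 1
      refine Finset.sum_congr rfl fun x _ => ?_
      rw [BeamFrame.vertexEnergy]
      ring
    · refine forall_congr' fun x => ?_
      simp only [BeamFrame.RigidAt, BeamFrame.NaturalAt, mem_empty_iff_false, not_false_eq_true,
        false_imp_iff, true_imp_iff, and_true, tan_div_two_smul_sub_eq_zero_iff (hα x),
        tan_div_two_smul_sub_eq_zero_iff (hβ x), and_assoc]
  -- At constrained joints the displacement or rotation is zero on the form domain (and `Real.tan`
  -- of π/2 is 0), so keeping the formal term in the energy is the same as omitting it.
  · refine (Γ.hasHamiltonian {x | α x = Real.pi / 2} {x | β x = Real.pi / 2}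
      (fun x => -Real.tan (α x)) (fun x => -Real.tan (β x))).congr
      (fun Ψ => Iff.rfl) (fun Ψ => ?_) (fun Ψ => ?_)
    · rw [sub_eq_add_neg, ← neg_mul, Finset.mul_sum]
      congr 1
      refine Finset.sum_congr rfl fun x _ => ?_
      rw [BeamFrame.vertexEnergy]
      ring
    · refine forall_congr' fun x => ?_
      rw [BeamFrame.VertexConditions, ← robin_iff (hα x), ← robin_iff (hβ x)]
      simp only [BeamFrame.RigidAt, BeamFrame.NaturalAt, mem_ofPred_eq]
      tauto
  · exact ⟨Γ.vertexConditions_free Ψ, Γ.vertexConditions_clamped Ψ, Γ.vertexConditions_pinned Ψ,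
      Γ.vertexConditions_guided Ψ⟩
  · have hd := Γ.forall_disp_eq_zero_iff_of_unique Ψ hx
    have hr := Γ.forall_rot_eq_zero_iff_of_unique Ψ hx
    have hF := Γ.force_eq_zero_iff_of_unique Ψ hx
    have hM := Γ.moment_eq_zero_iff_of_unique Ψ hx
    have hdc := Γ.dispContinuousAt_of_unique Ψ hx
    have hrc := Γ.rotContinuousAt_of_unique Ψ hx
    refine ⟨fun h h' => ?_, fun h h' => ?_, fun h h' => ?_, fun h h' => ?_⟩
    · rw [Γ.vertexConditions_free Ψ h h', hF, hM]
      exact ⟨fun H => H.2.2, fun H => ⟨hdc, hrc, H⟩⟩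
    · rw [Γ.vertexConditions_clamped Ψ h h', hd, hr]
    · rw [Γ.vertexConditions_pinned Ψ h h', hd, hM]
      exact ⟨fun H => ⟨H.1, H.2.2⟩, fun H => ⟨H.1, hrc, H.2⟩⟩
    · rw [Γ.vertexConditions_guided Ψ h h', hr, hF]
      exact ⟨fun H => ⟨H.1, H.2.2⟩, fun H => ⟨H.1, hdc, H.2⟩⟩
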